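/- \textbf{Setting.} Simplicial type theory is the following formal dependent type theory with three layers. Judgments are made in contexts $\Xi\mid\Phi\mid\Gamma$, where $\Xi$ is a list of cube variables, $\Phi$ a list of topes over $\Xi$, and $\Gamma$ a context of types over $\Xi\mid\Phi$. (1) \emph{Cubes} are the finite products of one generating cube $\mathbb 2$, which has two points $0,1:\mathbb 2$. (2) \emph{Topes} are the formulas built from $s\equiv t$ (for cube terms of the same cube) and $s\le t$ (for $s,t:\mathbb 2$) with $\top,\bot,\wedge,\vee$. Entailment $\Xi\mid\Phi\vdash\varphi$ is intuitionistic deduction with the usual rules of equality, the $\beta$- and $\eta$-rules of products, and the axioms of a strict interval: $\le$ is a total order on $\mathbb 2$ with least element $0$ and greatest element $1$, and $0\equiv 1$ entails $\bot$. (3) \emph{Types} form an intensional dependent type theory with a cumulative hierarchy of universes $\mathcal U_0:\mathcal U_1:\cdots$ closed under $\Pi$- and $\Sigma$-types (with judgmental $\beta$ and $\eta$), identity types, $\mathbf 0$, $\mathbf 1$, coproducts and $\mathbb N$; a type is an element of some universe. If $\Phi$ entails $\bot$, every type has exactly one element up to judgmental equality; if $\Phi$ entails $\varphi\vee\psi$,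 an element of a type is given uniquely by an element under $\varphi$ and an element under $\psi$ that are judgmentally equal under $\varphi\wedge\psi$. Equality topes give judgmental equalities under substitution. For topes $\varphi,\psi$ in one cube variable $t:I$ alone with $\varphi\vdash\psi$, a type $A$ over $t:I\mid\psi$ and an element $a:A$ over $t:I\mid\varphi$, there is an \emph{extension type} $\langle\prod_{t:I\mid\psi}A\,|^{\varphi}_{a}\rangle$ (its universe is that of $A$) of dependent functions on $\{t:I\mid\psi\}$ that are judgmentally equal to $a$ on $\varphi$, with $\beta$ and $\eta$. Finally, function extensionality (the canonical map $(f=g)\to\prod_x f(x)=g(x)$ is an equivalence) and relative function extensionality (if every $A(t)$ is contractible, then so is $\langle\prod_{t:I\mid\psi}A\,|^{\varphi}_{a}\rangle$) are assumed. \textbf{Definitions.} A type $X$ is contractible if $\sum_{x:X}\prod_{y:X}(x=y)$ has an element. A function $f:X\to Y$ is an equivalence if $\bigl(\sum_{g:Y\to X}\prod_{y}f(g(y))=y\bigr)\times\bigl(\sum_{h:Y\to X}\prod_{x}h(f(x))=x\bigr)$ has an element. For $x,y:A$, $\hom_A(x,y)$ is the extension type of functions $f:\mathbb 2\to A$ with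 $f(0)\equiv x$ and $f(1)\equiv y$; $\mathrm{id}_x:\hom_A(x,x)$ is the constant function. For $f:\hom_A(x,y)$, $g:\hom_A(y,z)$, $h:\hom_A(x,z)$, $\hom^2_A(x,y,z,f,g,h)$ is the extension type of functions $\sigma$ to $A$ on $\{\langle t_1,t_2\rangle:\mathbb 2\times\mathbb 2\mid t_2\le t_1\}$ with $\sigma\langle t,0\rangle\equiv f(t)$, $\sigma\langle 1,t\rangle\equiv g(t)$, $\sigma\langle t,t\rangle\equiv h(t)$. $A$ is a \emph{Segal type} if $\sum_{h:\hom_A(x,z)}\hom^2_A(x,y,z,f,g,h)$ is contractible for all $x,y,z:A$, $f:\hom_A(x,y)$, $g:\hom_A(y,z)$. For a family $D:B\to\mathcal U_j$, $f:\hom_B(x,y)$, $u:D(x)$, $v:D(y)$, let $\hom_{D(f)}(u,v)$ be the extension type of dependent functions $k:\prod_{t:\mathbb 2}D(f(t))$ with $k(0)\equiv u$ and $k(1)\equiv v$; $D$ is \emph{covariant} if $\sum_{v:D(y)}\hom_{D(f)}(u,v)$ is contractible for all $x,y:B$, $f:\hom_B(x,y)$, $u:D(x)$. A family $C:\prod_{x:A}(\hom_A(a,x)\to\mathcal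 U_j)$ is covariant if the uncurried family $\bigl(\sum_{x:A}\hom_A(a,x)\bigr)\to\mathcal U_j$ is. \textbf{Theorem (dependent Yoneda lemma).} In simplicial type theory, let $A$ be a Segal type, $a:A$, and let $C:\prod_{x:A}(\hom_A(a,x)\to\mathcal U_j)$ be covariant. Then the function \[\lambda\phi.\,\phi(a,\mathrm{id}_a)\;:\;\Bigl(\prod_{x:A}\prod_{f:\hom_A(a,x)}C(x,f)\Bigr)\to C(a,\mathrm{id}_a)\] is an equivalence. That is: in every context $\Xi\mid\Phi\mid\Gamma$, given types, terms and families $A$, $a$, $C$ derivable as above together with elements witnessing that $A$ is Segal and that $C$ is covariant, there is a term that the rules derive to be an element of the type stating that this function is an equivalence. -/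

import Mathlib

/-!
Simplicial type theory: a dependent type theory in three layers (cubes, topes, types), with the
coherent theory of a strict interval in the first two layers and with extension types.

Raw expressions are de Bruijn expressions.  Cube variables and type-theoretic variables are
numbered separately.  The judgments are inductively defined, and a theorem of the theory is the
derivability of a typing judgment.
-/

namespace STT

/-! ### Raw expressions -/

/-- Cubes: finite products of the generating cube `two`. -/
inductive Cube : Type
  | one : Cube
  | two : Cube
  | prod : Cube → Cube → Cube

/-- Cube terms; `zero` and `one` are the two end points of the cube `two`. -/
inductive CTm : Type
  | var : ℕ → CTm
  | star : CTm
  | pair : CTm → CTm → CTm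
  | fst : CTm → CTm
  | snd : CTm → CTm
  | zero : CTm
  | one : CTm

/-- Topes: formulas of coherent logic (without quantifiers) about cube terms. -/
inductive Tope : Type
  | top : Tope
  | bot : Tope
  | and : Tope → Tope → Tope
  | or : Tope → Tope → Tope
  | eq : CTm → CTm → Tope
  | le : CTm → CTm → Tope

/-- Types and terms (the universes are universes of types, so there is one sort of expressions).
The comments say which variables are bound.  In `ext`, `extLam` and `relFunext` the topes stand
in the cube context that consists of the bound variable alone, so that no other variable occurs
in them. -/
inductive Tm : Type
  | var : ℕ → Tm
  | univ : ℕ → Tm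
  /-- `∏ (x : A), B`; binds `x` in `B` -/
  | pi : Tm → Tm → Tm
  /-- `λ (x : A), b`; binds `x` in `b` -/
  | lam : Tm → Tm → Tm
  | app : Tm → Tm → Tm
  /-- `∑ (x : A), B`; binds `x` in `B` -/
  | sigma : Tm → Tm → Tm
  | pair : Tm → Tm → Tm
  | fst : Tm → Tm
  | snd : Tm → Tm
  /-- the identity type of `A` at `a`, `b` -/
  | id : Tm → Tm → Tm → Tm
  | refl : Tm → Tm
  /-- based path induction `J A a C c b p`; binds `y` and `q : a = y` in the motive `C` -/
  | J : Tm → Tm → Tm → Tm → Tm → Tm → Tm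
  | empty : Tm
  /-- `emptyInd C e`; binds one variable in `C` -/
  | emptyInd : Tm → Tm → Tm
  | unit : Tm
  | star : Tm
  /-- `unitInd C c u`; binds one variable in `C` -/
  | unitInd : Tm → Tm → Tm → Tm
  | sum : Tm → Tm → Tm
  | inl : Tm → Tm
  | inr : Tm → Tm
  /-- `sumInd C c d u`; binds one variable in each of `C`, `c`, `d` -/
  | sumInd : Tm → Tm → Tm → Tm → Tm
  | nat : Tm
  | zero : Tm
  | succ : Tm → Tm
  /-- `natInd C c d n`; binds one variable in `C` and two in `d` -/
  | natInd : Tm → Tm → Tm → Tm → Tm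
  /-- the element of every type over an inconsistent tope context -/
  | recBot : Tm
  /-- `recOr φ ψ a b` is `a` on `φ` and `b` on `ψ` -/
  | recOr : Tope → Tope → Tm → Tm → Tm
  /-- the extension type `⟨∏ (t : I | ψ), A | φ ↦ a⟩`, written `ext I ψ A φ a`; binds the cube
  variable `t` in `ψ`, `A`, `φ`, `a` -/
  | ext : Cube → Tope → Tm → Tope → Tm → Tm
  /-- `λ (t : I | ψ), b`; binds the cube variable `t` in `ψ` and `b` -/
  | extLam : Cube → Tope → Tm → Tm
  | extApp : Tm → CTm → Tm
  /-- function extensionality, `funext A B f g`; binds one variable in `B` -/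
  | funext : Tm → Tm → Tm → Tm → Tm
  /-- relative function extensionality, `relFunext I ψ A φ a c`; binds a cube variable in
  everything but `I` -/
  | relFunext : Cube → Tope → Tm → Tope → Tm → Tm → Tm

/-! ### Renaming and substitution -/

/-- Extend a renaming below a binder. -/
def upr (r : ℕ → ℕ) : ℕ → ℕ
  | 0 => 0
  | k + 1 => r k + 1

/-- Extend a sequence by a new entry at `0`. -/
def scons {α : Type} (a : α) (σ : ℕ → α) : ℕ → α
  | 0 => a
  | k + 1 => σ k

namespace CTm

def ren (r : ℕ → ℕ) : CTm → CTm
  | var k => var (r k)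
  | star => star
  | pair s t => pair (s.ren r) (t.ren r)
  | fst s => fst (s.ren r)
  | snd s => snd (s.ren r)
  | zero => zero
  | one => one

def sub (ρ : ℕ → CTm) : CTm → CTm
  | var k => ρ k
  | star => star
  | pair s t => pair (s.sub ρ) (t.sub ρ)
  | fst s => fst (s.sub ρ)
  | snd s => snd (s.sub ρ)
  | zero => zero
  | one => one

/-- Extend a cube substitution below a binder of a cube variable. -/
def up (ρ : ℕ → CTm) : ℕ → CTm :=
  scons (var 0) (fun k => (ρ k).ren Nat.succ)

end CTm

namespace Tope

def ren (r : ℕ → ℕ) : Tope → Tope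
  | top => top
  | bot => bot
  | and φ ψ => and (φ.ren r) (ψ.ren r)
  | or φ ψ => or (φ.ren r) (ψ.ren r)
  | eq s t => eq (s.ren r) (t.ren r)
  | le s t => le (s.ren r) (t.ren r)

def sub (ρ : ℕ → CTm) : Tope → Tope
  | top => top
  | bot => bot
  | and φ ψ => and (φ.sub ρ) (ψ.sub ρ)
  | or φ ψ => or (φ.sub ρ) (ψ.sub ρ)
  | eq s t => eq (s.sub ρ) (t.sub ρ)
  | le s t => le (s.sub ρ) (t.sub ρ)

/-- Weakening by a cube variable. -/
def wk (φ : Tope) : Tope := φ.ren Nat.succ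

/-- `φ[s/t]` for the last cube variable `t`. -/
def inst (φ : Tope) (s : CTm) : Tope := φ.sub (scons s CTm.var)

end Tope

namespace Tm

/-- Rename the cube variables by `r` and the other variables by `q`. -/
def ren (r q : ℕ → ℕ) : Tm → Tm
  | var k => var (q k)
  | univ i => univ i
  | pi A B => pi (A.ren r q) (B.ren r (upr q))
  | lam A b => lam (A.ren r q) (b.ren r (upr q))
  | app f a => app (f.ren r q) (a.ren r q)
  | sigma A B => sigma (A.ren r q) (B.ren r (upr q))
  | pair a b => pair (a.ren r q) (b.ren r q)
  | fst p => fst (p.ren r q)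
  | snd p => snd (p.ren r q)
  | id A a b => id (A.ren r q) (a.ren r q) (b.ren r q)
  | refl a => refl (a.ren r q)
  | J A a C c b p => J (A.ren r q) (a.ren r q) (C.ren r (upr (upr q))) (c.ren r q) (b.ren r q)
      (p.ren r q)
  | empty => empty
  | emptyInd C e => emptyInd (C.ren r (upr q)) (e.ren r q)
  | unit => unit
  | star => star
  | unitInd C c u => unitInd (C.ren r (upr q)) (c.ren r q) (u.ren r q)
  | sum A B => sum (A.ren r q) (B.ren r q)
  | inl a => inl (a.ren r q)
  | inr b => inr (b.ren r q)
  | sumInd C c d u => sumInd (C.ren r (upr q)) (c.ren r (upr q)) (d.ren r (upr q)) (u.ren r q)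
  | nat => nat
  | zero => zero
  | succ n => succ (n.ren r q)
  | natInd C c d n => natInd (C.ren r (upr q)) (c.ren r q) (d.ren r (upr (upr q))) (n.ren r q)
  | recBot => recBot
  | recOr φ ψ a b => recOr (φ.ren r) (ψ.ren r) (a.ren r q) (b.ren r q)
  | ext I ψ A φ a => ext I ψ (A.ren (upr r) q) φ (a.ren (upr r) q)
  | extLam I ψ b => extLam I ψ (b.ren (upr r) q)
  | extApp f s => extApp (f.ren r q) (s.ren r)
  | funext A B f g => funext (A.ren r q) (B.ren r (upr q)) (f.ren r q) (g.ren r q)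
  | relFunext I ψ A φ a c => relFunext I ψ (A.ren (upr r) q) φ (a.ren (upr r) q)
      (c.ren (upr r) q)

/-- Weakening by `k` variables. -/
def wkN (k : ℕ) (a : Tm) : Tm := a.ren _root_.id (fun n => n + k)

/-- Weakening by one variable. -/
def wk (a : Tm) : Tm := a.wkN 1

/-- Weakening by a cube variable. -/
def wkC (a : Tm) : Tm := a.ren Nat.succ _root_.id

/-- Extend a substitution below a binder. -/
def up (σ : ℕ → Tm) : ℕ → Tm := scons (var 0) (fun k => (σ k).wk)

/-- Extend a substitution below a binder of a cube variable. -/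
def upC (σ : ℕ → Tm) : ℕ → Tm := fun k => (σ k).wkC

/-- Substitute `ρ` for the cube variables and `σ` for the other variables. -/
def sub (ρ : ℕ → CTm) (σ : ℕ → Tm) : Tm → Tm
  | var k => σ k
  | univ i => univ i
  | pi A B => pi (A.sub ρ σ) (B.sub ρ (up σ))
  | lam A b => lam (A.sub ρ σ) (b.sub ρ (up σ))
  | app f a => app (f.sub ρ σ) (a.sub ρ σ)
  | sigma A B => sigma (A.sub ρ σ) (B.sub ρ (up σ))
  | pair a b => pair (a.sub ρ σ) (b.sub ρ σ)
  | fst p => fst (p.sub ρ σ)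
  | snd p => snd (p.sub ρ σ)
  | id A a b => id (A.sub ρ σ) (a.sub ρ σ) (b.sub ρ σ)
  | refl a => refl (a.sub ρ σ)
  | J A a C c b p => J (A.sub ρ σ) (a.sub ρ σ) (C.sub ρ (up (up σ))) (c.sub ρ σ) (b.sub ρ σ)
      (p.sub ρ σ)
  | empty => empty
  | emptyInd C e => emptyInd (C.sub ρ (up σ)) (e.sub ρ σ)
  | unit => unit
  | star => star
  | unitInd C c u => unitInd (C.sub ρ (up σ)) (c.sub ρ σ) (u.sub ρ σ)
  | sum A B => sum (A.sub ρ σ) (B.sub ρ σ)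
  | inl a => inl (a.sub ρ σ)
  | inr b => inr (b.sub ρ σ)
  | sumInd C c d u => sumInd (C.sub ρ (up σ)) (c.sub ρ (up σ)) (d.sub ρ (up σ)) (u.sub ρ σ)
  | nat => nat
  | zero => zero
  | succ n => succ (n.sub ρ σ)
  | natInd C c d n => natInd (C.sub ρ (up σ)) (c.sub ρ σ) (d.sub ρ (up (up σ))) (n.sub ρ σ)
  | recBot => recBot
  | recOr φ ψ a b => recOr (φ.sub ρ) (ψ.sub ρ) (a.sub ρ σ) (b.sub ρ σ)
  | ext I ψ A φ a => ext I ψ (A.sub (CTm.up ρ) (upC σ)) φ (a.sub (CTm.up ρ) (upC σ))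
  | extLam I ψ b => extLam I ψ (b.sub (CTm.up ρ) (upC σ))
  | extApp f s => extApp (f.sub ρ σ) (s.sub ρ)
  | funext A B f g => funext (A.sub ρ σ) (B.sub ρ (up σ)) (f.sub ρ σ) (g.sub ρ σ)
  | relFunext I ψ A φ a c => relFunext I ψ (A.sub (CTm.up ρ) (upC σ)) φ
      (a.sub (CTm.up ρ) (upC σ)) (c.sub (CTm.up ρ) (upC σ))

/-- Substitution for the variables that are not cube variables. -/
def tsub (σ : ℕ → Tm) (a : Tm) : Tm := a.sub CTm.var σ

/-- `b[a/x]` for the last variable `x`. -/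
def inst (b a : Tm) : Tm := b.tsub (scons a var)

/-- `b[a/x, p/y]` for the last two variables `x`, `y` (in this order). -/
def inst₂ (b a p : Tm) : Tm := b.tsub (scons p (scons a var))

/-- `a[s/t]` for the last cube variable `t`. -/
def instC (a : Tm) (s : CTm) : Tm := a.sub (scons s CTm.var) var

/-! ### Defined types of homotopy type theory -/

/-- The type of functions from `A` to `B`. -/
def arrow (A B : Tm) : Tm := pi A B.wk

/-- The product of two types. -/
def prod (A B : Tm) : Tm := sigma A B.wk

/-- `∑ (a : A), ∏ (x : A), a = x`. -/
def isContr (A : Tm) : Tm := sigma A (pi A.wk (id (A.wkN 2) (var 1) (var 0)))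

/-- `f : A → B` is an equivalence: it has a right inverse and a left inverse,
`(∑ (g : B → A), ∏ (y : B), f (g y) = y) × (∑ (h : B → A), ∏ (x : A), h (f x) = x)`. -/
def isEquiv (A B f : Tm) : Tm :=
  prod
    (sigma (arrow B A)
      (pi B.wk (id (B.wkN 2) (app (f.wkN 2) (app (var 1) (var 0))) (var 0))))
    (sigma (arrow B A)
      (pi A.wk (id (A.wkN 2) (app (var 1) (app (f.wkN 2) (var 0))) (var 0))))

/-- The type `∏ (x : A), f x = g x` of homotopies between `f g : ∏ (x : A), B`. -/
def homotopy (A B f g : Tm) : Tm := pi A (id B (app f.wk (var 0)) (app g.wk (var 0)))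

/-- The canonical map from `f = g` to `∏ (x : A), f x = g x`, defined by path induction. -/
def happly (A B f g : Tm) : Tm :=
  lam (id (pi A B) f g)
    (J (pi A B).wk f.wk
      (homotopy (A.wkN 3) (B.ren _root_.id (upr (fun n => n + 3))) (f.wkN 3) (var 1))
      (lam A.wk (refl (app (f.wkN 2) (var 0))))
      g.wk (var 0))

end Tm

/-! ### The cube layer and the tope layer -/

/-- `CTy Ξ t I` is the judgment `Ξ ⊢ t : I`.  The head of the list `Ξ` is the last variable. -/
inductive CTy : List Cube → CTm → Cube → Prop
  | var {Ξ : List Cube} {k : ℕ} {I : Cube} : Ξ[k]? = some I → CTy Ξ (.var k) I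
  | star {Ξ : List Cube} : CTy Ξ .star .one
  | pair {Ξ : List Cube} {s t : CTm} {I J : Cube} :
      CTy Ξ s I → CTy Ξ t J → CTy Ξ (.pair s t) (.prod I J)
  | fst {Ξ : List Cube} {t : CTm} {I J : Cube} : CTy Ξ t (.prod I J) → CTy Ξ (.fst t) I
  | snd {Ξ : List Cube} {t : CTm} {I J : Cube} : CTy Ξ t (.prod I J) → CTy Ξ (.snd t) J
  | zero {Ξ : List Cube} : CTy Ξ .zero .two
  | one {Ξ : List Cube} : CTy Ξ .one .two

/-- `IsTope Ξ φ` is the judgment `Ξ ⊢ φ tope`. -/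
inductive IsTope : List Cube → Tope → Prop
  | top {Ξ : List Cube} : IsTope Ξ .top
  | bot {Ξ : List Cube} : IsTope Ξ .bot
  | and {Ξ : List Cube} {φ ψ : Tope} : IsTope Ξ φ → IsTope Ξ ψ → IsTope Ξ (.and φ ψ)
  | or {Ξ : List Cube} {φ ψ : Tope} : IsTope Ξ φ → IsTope Ξ ψ → IsTope Ξ (.or φ ψ)
  | eq {Ξ : List Cube} {s t : CTm} {I : Cube} : CTy Ξ s I → CTy Ξ t I → IsTope Ξ (.eq s t)
  | le {Ξ : List Cube} {s t : CTm} : CTy Ξ s .two → CTy Ξ t .two → IsTope Ξ (.le s t)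

/-- `Ent Ξ Φ φ` is the judgment `Ξ | Φ ⊢ φ`: entailment in coherent logic over the theory of a
strict interval. -/
inductive Ent : List Cube → List Tope → Tope → Prop
  | hyp {Ξ : List Cube} {Φ : List Tope} {φ : Tope} : φ ∈ Φ → Ent Ξ Φ φ
  | top {Ξ : List Cube} {Φ : List Tope} : Ent Ξ Φ .top
  | botElim {Ξ : List Cube} {Φ : List Tope} {ψ : Tope} :
      Ent Ξ Φ .bot → IsTope Ξ ψ → Ent Ξ Φ ψ
  | andIntro {Ξ : List Cube} {Φ : List Tope} {φ ψ : Tope} :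
      Ent Ξ Φ φ → Ent Ξ Φ ψ → Ent Ξ Φ (.and φ ψ)
  | andLeft {Ξ : List Cube} {Φ : List Tope} {φ ψ : Tope} : Ent Ξ Φ (.and φ ψ) → Ent Ξ Φ φ
  | andRight {Ξ : List Cube} {Φ : List Tope} {φ ψ : Tope} : Ent Ξ Φ (.and φ ψ) → Ent Ξ Φ ψ
  | orLeft {Ξ : List Cube} {Φ : List Tope} {φ ψ : Tope} :
      Ent Ξ Φ φ → IsTope Ξ ψ → Ent Ξ Φ (.or φ ψ)
  | orRight {Ξ : List Cube} {Φ : List Tope} {φ ψ : Tope} :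
      Ent Ξ Φ ψ → IsTope Ξ φ → Ent Ξ Φ (.or φ ψ)
  | orElim {Ξ : List Cube} {Φ : List Tope} {φ ψ χ : Tope} :
      Ent Ξ (φ :: Φ) χ → Ent Ξ (ψ :: Φ) χ → Ent Ξ Φ (.or φ ψ) → Ent Ξ Φ χ
  | eqRefl {Ξ : List Cube} {Φ : List Tope} {s : CTm} {I : Cube} : CTy Ξ s I → Ent Ξ Φ (.eq s s)
  | eqSymm {Ξ : List Cube} {Φ : List Tope} {s t : CTm} : Ent Ξ Φ (.eq s t) → Ent Ξ Φ (.eq t s)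
  | eqTrans {Ξ : List Cube} {Φ : List Tope} {s t v : CTm} :
      Ent Ξ Φ (.eq s t) → Ent Ξ Φ (.eq t v) → Ent Ξ Φ (.eq s v)
  | eqSubst {Ξ : List Cube} {Φ : List Tope} {s t : CTm} {I : Cube} {ψ : Tope} :
      CTy Ξ s I → CTy Ξ t I → IsTope (I :: Ξ) ψ →
      Ent Ξ Φ (.eq s t) → Ent Ξ Φ (ψ.inst s) → Ent Ξ Φ (ψ.inst t)
  | starEta {Ξ : List Cube} {Φ : List Tope} {t : CTm} : CTy Ξ t .one → Ent Ξ Φ (.eq t .star)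
  | fstBeta {Ξ : List Cube} {Φ : List Tope} {s t : CTm} {I J : Cube} :
      CTy Ξ s I → CTy Ξ t J → Ent Ξ Φ (.eq (.fst (.pair s t)) s)
  | sndBeta {Ξ : List Cube} {Φ : List Tope} {s t : CTm} {I J : Cube} :
      CTy Ξ s I → CTy Ξ t J → Ent Ξ Φ (.eq (.snd (.pair s t)) t)
  | pairEta {Ξ : List Cube} {Φ : List Tope} {t : CTm} {I J : Cube} :
      CTy Ξ t (.prod I J) → Ent Ξ Φ (.eq t (.pair (.fst t) (.snd t)))
  | leRefl {Ξ : List Cube} {Φ : List Tope} {x : CTm} : CTy Ξ x .two → Ent Ξ Φ (.le x x)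
  | leTrans {Ξ : List Cube} {Φ : List Tope} {x y z : CTm} :
      Ent Ξ Φ (.le x y) → Ent Ξ Φ (.le y z) → Ent Ξ Φ (.le x z)
  | leAntisymm {Ξ : List Cube} {Φ : List Tope} {x y : CTm} :
      Ent Ξ Φ (.le x y) → Ent Ξ Φ (.le y x) → Ent Ξ Φ (.eq x y)
  | leTotal {Ξ : List Cube} {Φ : List Tope} {x y : CTm} :
      CTy Ξ x .two → CTy Ξ y .two → Ent Ξ Φ (.or (.le x y) (.le y x))
  | zeroLe {Ξ : List Cube} {Φ : List Tope} {x : CTm} : CTy Ξ x .two → Ent Ξ Φ (.le .zero x)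
  | leOne {Ξ : List Cube} {Φ : List Tope} {x : CTm} : CTy Ξ x .two → Ent Ξ Φ (.le x .one)
  | zeroNeOne {Ξ : List Cube} {Φ : List Tope} : Ent Ξ Φ (.eq .zero .one) → Ent Ξ Φ .bot

/-! ### The type layer -/

/-- The right-hand sides of the judgments of the type layer.  There is no separate judgment that
`A` is a type: the types are the elements of the universes `univ i`. -/
inductive Jdg : Type
  /-- the context is well formed -/
  | ctx : Jdg
  /-- `a : A` -/
  | tm : Tm → Tm → Jdg
  /-- `a ≡ b : A` (judgmental equality) -/
  | eq : Tm → Tm → Tm → Jdg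

def Jdg.sub (ρ : ℕ → CTm) (σ : ℕ → Tm) : Jdg → Jdg
  | ctx => ctx
  | tm a A => tm (a.sub ρ σ) (A.sub ρ σ)
  | eq a b A => eq (a.sub ρ σ) (b.sub ρ σ) (A.sub ρ σ)

/-- `Der Ξ Φ Γ j` says that the judgment `Ξ | Φ | Γ ⊢ j` is derivable.  The head of each list is
its last entry, and each type in `Γ` may use the variables that come before it. -/
inductive Der : List Cube → List Tope → List Tm → Jdg → Prop
  -- contexts, variables, substitution
  | ctxNil {Ξ : List Cube} {Φ : List Tope} :
      (∀ φ ∈ Φ, IsTope Ξ φ) → Der Ξ Φ [] .ctx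
  | ctxCons {Ξ : List Cube} {Φ : List Tope} {Γ : List Tm} {A : Tm} {i : ℕ} :
      Der Ξ Φ Γ .ctx → Der Ξ Φ Γ (.tm A (.univ i)) → Der Ξ Φ (A :: Γ) .ctx
  | var {Ξ : List Cube} {Φ : List Tope} {Γ : List Tm} {k : ℕ} {A : Tm} :
      Der Ξ Φ Γ .ctx → Γ[k]? = some A → Der Ξ Φ Γ (.tm (.var k) (A.wkN (k + 1)))
  /-- Substitution along an arbitrary context morphism `(ρ, σ)`.  This comprises weakening,
  substitution of cube terms, cut for topes, and substitution of terms. -/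
  | subst {Ξ Ξ' : List Cube} {Φ Φ' : List Tope} {Γ Γ' : List Tm} {j : Jdg}
      {ρ : ℕ → CTm} {σ : ℕ → Tm} :
      Der Ξ Φ Γ j → Der Ξ' Φ' Γ' .ctx →
      (∀ k I, Ξ[k]? = some I → CTy Ξ' (ρ k) I) →
      (∀ φ ∈ Φ, Ent Ξ' Φ' (φ.sub ρ)) →
      (∀ k A, Γ[k]? = some A → Der Ξ' Φ' Γ' (.tm (σ k) ((A.wkN (k + 1)).sub ρ σ))) →
      Der Ξ' Φ' Γ' (j.sub ρ σ)
  /-- Substitution respects judgmental equality of terms, and it takes equality topes to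
  judgmental equalities. -/
  | substCong {Ξ Ξ' : List Cube} {Φ Φ' : List Tope} {Γ Γ' : List Tm} {a A : Tm}
      {ρ ρ' : ℕ → CTm} {σ σ' : ℕ → Tm} :
      Der Ξ Φ Γ (.tm a A) → Der Ξ' Φ' Γ' .ctx →
      (∀ k I, Ξ[k]? = some I → CTy Ξ' (ρ k) I) →
      (∀ k I, Ξ[k]? = some I → CTy Ξ' (ρ' k) I) →
      (∀ k I, Ξ[k]? = some I → Ent Ξ' Φ' (.eq (ρ k) (ρ' k))) →
      (∀ φ ∈ Φ, Ent Ξ' Φ' (φ.sub ρ)) →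
      (∀ k A, Γ[k]? = some A →
        Der Ξ' Φ' Γ' (.eq (σ k) (σ' k) ((A.wkN (k + 1)).sub ρ σ))) →
      Der Ξ' Φ' Γ' (.eq (a.sub ρ σ) (a.sub ρ' σ') (A.sub ρ σ))
  -- judgmental equality
  | eqRefl {Ξ : List Cube} {Φ : List Tope} {Γ : List Tm} {a A : Tm} :
      Der Ξ Φ Γ (.tm a A) → Der Ξ Φ Γ (.eq a a A)
  | eqSymm {Ξ : List Cube} {Φ : List Tope} {Γ : List Tm} {a b A : Tm} :
      Der Ξ Φ Γ (.eq a b A) → Der Ξ Φ Γ (.eq b a A)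
  | eqTrans {Ξ : List Cube} {Φ : List Tope} {Γ : List Tm} {a b c A : Tm} :
      Der Ξ Φ Γ (.eq a b A) → Der Ξ Φ Γ (.eq b c A) → Der Ξ Φ Γ (.eq a c A)
  | conv {Ξ : List Cube} {Φ : List Tope} {Γ : List Tm} {a A B : Tm} {i : ℕ} :
      Der Ξ Φ Γ (.tm a A) → Der Ξ Φ Γ (.eq A B (.univ i)) → Der Ξ Φ Γ (.tm a B)
  | convEq {Ξ : List Cube} {Φ : List Tope} {Γ : List Tm} {a b A B : Tm} {i : ℕ} :
      Der Ξ Φ Γ (.eq a b A) → Der Ξ Φ Γ (.eq A B (.univ i)) → Der Ξ Φ Γ (.eq a b B)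
  -- universes
  | univ {Ξ : List Cube} {Φ : List Tope} {Γ : List Tm} {i : ℕ} :
      Der Ξ Φ Γ .ctx → Der Ξ Φ Γ (.tm (.univ i) (.univ (i + 1)))
  | cumul {Ξ : List Cube} {Φ : List Tope} {Γ : List Tm} {A : Tm} {i : ℕ} :
      Der Ξ Φ Γ (.tm A (.univ i)) → Der Ξ Φ Γ (.tm A (.univ (i + 1)))
  | cumulEq {Ξ : List Cube} {Φ : List Tope} {Γ : List Tm} {A B : Tm} {i : ℕ} :
      Der Ξ Φ Γ (.eq A B (.univ i)) → Der Ξ Φ Γ (.eq A B (.univ (i + 1)))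
  -- dependent function types
  | pi {Ξ : List Cube} {Φ : List Tope} {Γ : List Tm} {A B : Tm} {i : ℕ} :
      Der Ξ Φ Γ (.tm A (.univ i)) → Der Ξ Φ (A :: Γ) (.tm B (.univ i)) →
      Der Ξ Φ Γ (.tm (.pi A B) (.univ i))
  | piCong {Ξ : List Cube} {Φ : List Tope} {Γ : List Tm} {A A' B B' : Tm} {i : ℕ} :
      Der Ξ Φ Γ (.eq A A' (.univ i)) → Der Ξ Φ (A :: Γ) (.eq B B' (.univ i)) →
      Der Ξ Φ Γ (.eq (.pi A B) (.pi A' B') (.univ i))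
  | lam {Ξ : List Cube} {Φ : List Tope} {Γ : List Tm} {A B b : Tm} {i : ℕ} :
      Der Ξ Φ Γ (.tm A (.univ i)) → Der Ξ Φ (A :: Γ) (.tm b B) →
      Der Ξ Φ Γ (.tm (.lam A b) (.pi A B))
  | lamCong {Ξ : List Cube} {Φ : List Tope} {Γ : List Tm} {A A' B b b' : Tm} {i : ℕ} :
      Der Ξ Φ Γ (.eq A A' (.univ i)) → Der Ξ Φ (A :: Γ) (.eq b b' B) →
      Der Ξ Φ Γ (.eq (.lam A b) (.lam A' b') (.pi A B))
  | app {Ξ : List Cube} {Φ : List Tope} {Γ : List Tm} {A B f a : Tm} :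
      Der Ξ Φ Γ (.tm f (.pi A B)) → Der Ξ Φ Γ (.tm a A) →
      Der Ξ Φ Γ (.tm (.app f a) (B.inst a))
  | appCong {Ξ : List Cube} {Φ : List Tope} {Γ : List Tm} {A B f f' a a' : Tm} :
      Der Ξ Φ Γ (.eq f f' (.pi A B)) → Der Ξ Φ Γ (.eq a a' A) →
      Der Ξ Φ Γ (.eq (.app f a) (.app f' a') (B.inst a))
  | piBeta {Ξ : List Cube} {Φ : List Tope} {Γ : List Tm} {A B b a : Tm} :
      Der Ξ Φ (A :: Γ) (.tm b B) → Der Ξ Φ Γ (.tm a A) →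
      Der Ξ Φ Γ (.eq (.app (.lam A b) a) (b.inst a) (B.inst a))
  | piEta {Ξ : List Cube} {Φ : List Tope} {Γ : List Tm} {A B f : Tm} :
      Der Ξ Φ Γ (.tm f (.pi A B)) →
      Der Ξ Φ Γ (.eq f (.lam A (.app f.wk (.var 0))) (.pi A B))
  -- dependent pair types
  | sigma {Ξ : List Cube} {Φ : List Tope} {Γ : List Tm} {A B : Tm} {i : ℕ} :
      Der Ξ Φ Γ (.tm A (.univ i)) → Der Ξ Φ (A :: Γ) (.tm B (.univ i)) →
      Der Ξ Φ Γ (.tm (.sigma A B) (.univ i))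
  | sigmaCong {Ξ : List Cube} {Φ : List Tope} {Γ : List Tm} {A A' B B' : Tm} {i : ℕ} :
      Der Ξ Φ Γ (.eq A A' (.univ i)) → Der Ξ Φ (A :: Γ) (.eq B B' (.univ i)) →
      Der Ξ Φ Γ (.eq (.sigma A B) (.sigma A' B') (.univ i))
  | pair {Ξ : List Cube} {Φ : List Tope} {Γ : List Tm} {A B a b : Tm} {i : ℕ} :
      Der Ξ Φ (A :: Γ) (.tm B (.univ i)) → Der Ξ Φ Γ (.tm a A) →
      Der Ξ Φ Γ (.tm b (B.inst a)) → Der Ξ Φ Γ (.tm (.pair a b) (.sigma A B))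
  | pairCong {Ξ : List Cube} {Φ : List Tope} {Γ : List Tm} {A B a a' b b' : Tm} {i : ℕ} :
      Der Ξ Φ (A :: Γ) (.tm B (.univ i)) → Der Ξ Φ Γ (.eq a a' A) →
      Der Ξ Φ Γ (.eq b b' (B.inst a)) →
      Der Ξ Φ Γ (.eq (.pair a b) (.pair a' b') (.sigma A B))
  | fst {Ξ : List Cube} {Φ : List Tope} {Γ : List Tm} {A B p : Tm} :
      Der Ξ Φ Γ (.tm p (.sigma A B)) → Der Ξ Φ Γ (.tm (.fst p) A)
  | fstCong {Ξ : List Cube} {Φ : List Tope} {Γ : List Tm} {A B p p' : Tm} :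
      Der Ξ Φ Γ (.eq p p' (.sigma A B)) → Der Ξ Φ Γ (.eq (.fst p) (.fst p') A)
  | snd {Ξ : List Cube} {Φ : List Tope} {Γ : List Tm} {A B p : Tm} :
      Der Ξ Φ Γ (.tm p (.sigma A B)) → Der Ξ Φ Γ (.tm (.snd p) (B.inst (.fst p)))
  | sndCong {Ξ : List Cube} {Φ : List Tope} {Γ : List Tm} {A B p p' : Tm} :
      Der Ξ Φ Γ (.eq p p' (.sigma A B)) →
      Der Ξ Φ Γ (.eq (.snd p) (.snd p') (B.inst (.fst p)))
  | fstBeta {Ξ : List Cube} {Φ : List Tope} {Γ : List Tm} {A B a b : Tm} {i : ℕ} :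
      Der Ξ Φ (A :: Γ) (.tm B (.univ i)) → Der Ξ Φ Γ (.tm a A) →
      Der Ξ Φ Γ (.tm b (B.inst a)) → Der Ξ Φ Γ (.eq (.fst (.pair a b)) a A)
  | sndBeta {Ξ : List Cube} {Φ : List Tope} {Γ : List Tm} {A B a b : Tm} {i : ℕ} :
      Der Ξ Φ (A :: Γ) (.tm B (.univ i)) → Der Ξ Φ Γ (.tm a A) →
      Der Ξ Φ Γ (.tm b (B.inst a)) → Der Ξ Φ Γ (.eq (.snd (.pair a b)) b (B.inst a))
  | sigmaEta {Ξ : List Cube} {Φ : List Tope} {Γ : List Tm} {A B p : Tm} :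
      Der Ξ Φ Γ (.tm p (.sigma A B)) →
      Der Ξ Φ Γ (.eq p (.pair (.fst p) (.snd p)) (.sigma A B))
  -- identity types
  | id {Ξ : List Cube} {Φ : List Tope} {Γ : List Tm} {A a b : Tm} {i : ℕ} :
      Der Ξ Φ Γ (.tm A (.univ i)) → Der Ξ Φ Γ (.tm a A) → Der Ξ Φ Γ (.tm b A) →
      Der Ξ Φ Γ (.tm (.id A a b) (.univ i))
  | idCong {Ξ : List Cube} {Φ : List Tope} {Γ : List Tm} {A A' a a' b b' : Tm} {i : ℕ} :
      Der Ξ Φ Γ (.eq A A' (.univ i)) → Der Ξ Φ Γ (.eq a a' A) → Der Ξ Φ Γ (.eq b b' A) →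
      Der Ξ Φ Γ (.eq (.id A a b) (.id A' a' b') (.univ i))
  | refl {Ξ : List Cube} {Φ : List Tope} {Γ : List Tm} {A a : Tm} :
      Der Ξ Φ Γ (.tm a A) → Der Ξ Φ Γ (.tm (.refl a) (.id A a a))
  | reflCong {Ξ : List Cube} {Φ : List Tope} {Γ : List Tm} {A a a' : Tm} :
      Der Ξ Φ Γ (.eq a a' A) → Der Ξ Φ Γ (.eq (.refl a) (.refl a') (.id A a a))
  | J {Ξ : List Cube} {Φ : List Tope} {Γ : List Tm} {A a C c b p : Tm} {i : ℕ} :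
      Der Ξ Φ Γ (.tm a A) →
      Der Ξ Φ (.id A.wk a.wk (.var 0) :: A :: Γ) (.tm C (.univ i)) →
      Der Ξ Φ Γ (.tm c (C.inst₂ a (.refl a))) →
      Der Ξ Φ Γ (.tm b A) → Der Ξ Φ Γ (.tm p (.id A a b)) →
      Der Ξ Φ Γ (.tm (.J A a C c b p) (C.inst₂ b p))
  | JCong {Ξ : List Cube} {Φ : List Tope} {Γ : List Tm}
      {A A' a a' C C' c c' b b' p p' : Tm} {i k : ℕ} :
      Der Ξ Φ Γ (.eq A A' (.univ k)) → Der Ξ Φ Γ (.eq a a' A) →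
      Der Ξ Φ (.id A.wk a.wk (.var 0) :: A :: Γ) (.eq C C' (.univ i)) →
      Der Ξ Φ Γ (.eq c c' (C.inst₂ a (.refl a))) →
      Der Ξ Φ Γ (.eq b b' A) → Der Ξ Φ Γ (.eq p p' (.id A a b)) →
      Der Ξ Φ Γ (.eq (.J A a C c b p) (.J A' a' C' c' b' p') (C.inst₂ b p))
  | JBeta {Ξ : List Cube} {Φ : List Tope} {Γ : List Tm} {A a C c : Tm} {i : ℕ} :
      Der Ξ Φ Γ (.tm a A) →
      Der Ξ Φ (.id A.wk a.wk (.var 0) :: A :: Γ) (.tm C (.univ i)) →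
      Der Ξ Φ Γ (.tm c (C.inst₂ a (.refl a))) →
      Der Ξ Φ Γ (.eq (.J A a C c a (.refl a)) c (C.inst₂ a (.refl a)))
  -- the empty type
  | empty {Ξ : List Cube} {Φ : List Tope} {Γ : List Tm} {i : ℕ} :
      Der Ξ Φ Γ .ctx → Der Ξ Φ Γ (.tm .empty (.univ i))
  | emptyInd {Ξ : List Cube} {Φ : List Tope} {Γ : List Tm} {C e : Tm} {i : ℕ} :
      Der Ξ Φ (.empty :: Γ) (.tm C (.univ i)) → Der Ξ Φ Γ (.tm e .empty) →
      Der Ξ Φ Γ (.tm (.emptyInd C e) (C.inst e))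
  | emptyIndCong {Ξ : List Cube} {Φ : List Tope} {Γ : List Tm} {C C' e e' : Tm} {i : ℕ} :
      Der Ξ Φ (.empty :: Γ) (.eq C C' (.univ i)) → Der Ξ Φ Γ (.eq e e' .empty) →
      Der Ξ Φ Γ (.eq (.emptyInd C e) (.emptyInd C' e') (C.inst e))
  -- the unit type
  | unit {Ξ : List Cube} {Φ : List Tope} {Γ : List Tm} {i : ℕ} :
      Der Ξ Φ Γ .ctx → Der Ξ Φ Γ (.tm .unit (.univ i))
  | star {Ξ : List Cube} {Φ : List Tope} {Γ : List Tm} :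
      Der Ξ Φ Γ .ctx → Der Ξ Φ Γ (.tm .star .unit)
  | unitInd {Ξ : List Cube} {Φ : List Tope} {Γ : List Tm} {C c u : Tm} {i : ℕ} :
      Der Ξ Φ (.unit :: Γ) (.tm C (.univ i)) → Der Ξ Φ Γ (.tm c (C.inst .star)) →
      Der Ξ Φ Γ (.tm u .unit) → Der Ξ Φ Γ (.tm (.unitInd C c u) (C.inst u))
  | unitIndCong {Ξ : List Cube} {Φ : List Tope} {Γ : List Tm} {C C' c c' u u' : Tm} {i : ℕ} :
      Der Ξ Φ (.unit :: Γ) (.eq C C' (.univ i)) → Der Ξ Φ Γ (.eq c c' (C.inst .star)) →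
      Der Ξ Φ Γ (.eq u u' .unit) →
      Der Ξ Φ Γ (.eq (.unitInd C c u) (.unitInd C' c' u') (C.inst u))
  | unitBeta {Ξ : List Cube} {Φ : List Tope} {Γ : List Tm} {C c : Tm} {i : ℕ} :
      Der Ξ Φ (.unit :: Γ) (.tm C (.univ i)) → Der Ξ Φ Γ (.tm c (C.inst .star)) →
      Der Ξ Φ Γ (.eq (.unitInd C c .star) c (C.inst .star))
  -- coproduct types
  | sum {Ξ : List Cube} {Φ : List Tope} {Γ : List Tm} {A B : Tm} {i : ℕ} :
      Der Ξ Φ Γ (.tm A (.univ i)) → Der Ξ Φ Γ (.tm B (.univ i)) →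
      Der Ξ Φ Γ (.tm (.sum A B) (.univ i))
  | sumCong {Ξ : List Cube} {Φ : List Tope} {Γ : List Tm} {A A' B B' : Tm} {i : ℕ} :
      Der Ξ Φ Γ (.eq A A' (.univ i)) → Der Ξ Φ Γ (.eq B B' (.univ i)) →
      Der Ξ Φ Γ (.eq (.sum A B) (.sum A' B') (.univ i))
  | inl {Ξ : List Cube} {Φ : List Tope} {Γ : List Tm} {A B a : Tm} {i : ℕ} :
      Der Ξ Φ Γ (.tm B (.univ i)) → Der Ξ Φ Γ (.tm a A) →
      Der Ξ Φ Γ (.tm (.inl a) (.sum A B))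
  | inlCong {Ξ : List Cube} {Φ : List Tope} {Γ : List Tm} {A B a a' : Tm} {i : ℕ} :
      Der Ξ Φ Γ (.tm B (.univ i)) → Der Ξ Φ Γ (.eq a a' A) →
      Der Ξ Φ Γ (.eq (.inl a) (.inl a') (.sum A B))
  | inr {Ξ : List Cube} {Φ : List Tope} {Γ : List Tm} {A B b : Tm} {i : ℕ} :
      Der Ξ Φ Γ (.tm A (.univ i)) → Der Ξ Φ Γ (.tm b B) →
      Der Ξ Φ Γ (.tm (.inr b) (.sum A B))
  | inrCong {Ξ : List Cube} {Φ : List Tope} {Γ : List Tm} {A B b b' : Tm} {i : ℕ} :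
      Der Ξ Φ Γ (.tm A (.univ i)) → Der Ξ Φ Γ (.eq b b' B) →
      Der Ξ Φ Γ (.eq (.inr b) (.inr b') (.sum A B))
  | sumInd {Ξ : List Cube} {Φ : List Tope} {Γ : List Tm} {A B C c d u : Tm} {i : ℕ} :
      Der Ξ Φ (.sum A B :: Γ) (.tm C (.univ i)) →
      Der Ξ Φ (A :: Γ) (.tm c (C.tsub (scons (.inl (.var 0)) (fun k => .var (k + 1))))) →
      Der Ξ Φ (B :: Γ) (.tm d (C.tsub (scons (.inr (.var 0)) (fun k => .var (k + 1))))) →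
      Der Ξ Φ Γ (.tm u (.sum A B)) → Der Ξ Φ Γ (.tm (.sumInd C c d u) (C.inst u))
  | sumIndCong {Ξ : List Cube} {Φ : List Tope} {Γ : List Tm}
      {A B C C' c c' d d' u u' : Tm} {i : ℕ} :
      Der Ξ Φ (.sum A B :: Γ) (.eq C C' (.univ i)) →
      Der Ξ Φ (A :: Γ) (.eq c c' (C.tsub (scons (.inl (.var 0)) (fun k => .var (k + 1))))) →
      Der Ξ Φ (B :: Γ) (.eq d d' (C.tsub (scons (.inr (.var 0)) (fun k => .var (k + 1))))) →
      Der Ξ Φ Γ (.eq u u' (.sum A B)) →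
      Der Ξ Φ Γ (.eq (.sumInd C c d u) (.sumInd C' c' d' u') (C.inst u))
  | sumBetaInl {Ξ : List Cube} {Φ : List Tope} {Γ : List Tm} {A B C c d a : Tm} {i : ℕ} :
      Der Ξ Φ (.sum A B :: Γ) (.tm C (.univ i)) →
      Der Ξ Φ (A :: Γ) (.tm c (C.tsub (scons (.inl (.var 0)) (fun k => .var (k + 1))))) →
      Der Ξ Φ (B :: Γ) (.tm d (C.tsub (scons (.inr (.var 0)) (fun k => .var (k + 1))))) →
      Der Ξ Φ Γ (.tm a A) →
      Der Ξ Φ Γ (.eq (.sumInd C c d (.inl a)) (c.inst a) (C.inst (.inl a)))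
  | sumBetaInr {Ξ : List Cube} {Φ : List Tope} {Γ : List Tm} {A B C c d b : Tm} {i : ℕ} :
      Der Ξ Φ (.sum A B :: Γ) (.tm C (.univ i)) →
      Der Ξ Φ (A :: Γ) (.tm c (C.tsub (scons (.inl (.var 0)) (fun k => .var (k + 1))))) →
      Der Ξ Φ (B :: Γ) (.tm d (C.tsub (scons (.inr (.var 0)) (fun k => .var (k + 1))))) →
      Der Ξ Φ Γ (.tm b B) →
      Der Ξ Φ Γ (.eq (.sumInd C c d (.inr b)) (d.inst b) (C.inst (.inr b)))
  -- natural numbers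
  | nat {Ξ : List Cube} {Φ : List Tope} {Γ : List Tm} {i : ℕ} :
      Der Ξ Φ Γ .ctx → Der Ξ Φ Γ (.tm .nat (.univ i))
  | zero {Ξ : List Cube} {Φ : List Tope} {Γ : List Tm} :
      Der Ξ Φ Γ .ctx → Der Ξ Φ Γ (.tm .zero .nat)
  | succ {Ξ : List Cube} {Φ : List Tope} {Γ : List Tm} {n : Tm} :
      Der Ξ Φ Γ (.tm n .nat) → Der Ξ Φ Γ (.tm (.succ n) .nat)
  | succCong {Ξ : List Cube} {Φ : List Tope} {Γ : List Tm} {n n' : Tm} :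
      Der Ξ Φ Γ (.eq n n' .nat) → Der Ξ Φ Γ (.eq (.succ n) (.succ n') .nat)
  | natInd {Ξ : List Cube} {Φ : List Tope} {Γ : List Tm} {C c d n : Tm} {i : ℕ} :
      Der Ξ Φ (.nat :: Γ) (.tm C (.univ i)) → Der Ξ Φ Γ (.tm c (C.inst .zero)) →
      Der Ξ Φ (C :: .nat :: Γ)
        (.tm d (C.tsub (scons (.succ (.var 1)) (fun k => .var (k + 2))))) →
      Der Ξ Φ Γ (.tm n .nat) → Der Ξ Φ Γ (.tm (.natInd C c d n) (C.inst n))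
  | natIndCong {Ξ : List Cube} {Φ : List Tope} {Γ : List Tm}
      {C C' c c' d d' n n' : Tm} {i : ℕ} :
      Der Ξ Φ (.nat :: Γ) (.eq C C' (.univ i)) → Der Ξ Φ Γ (.eq c c' (C.inst .zero)) →
      Der Ξ Φ (C :: .nat :: Γ)
        (.eq d d' (C.tsub (scons (.succ (.var 1)) (fun k => .var (k + 2))))) →
      Der Ξ Φ Γ (.eq n n' .nat) →
      Der Ξ Φ Γ (.eq (.natInd C c d n) (.natInd C' c' d' n') (C.inst n))
  | natBetaZero {Ξ : List Cube} {Φ : List Tope} {Γ : List Tm} {C c d : Tm} {i : ℕ} :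
      Der Ξ Φ (.nat :: Γ) (.tm C (.univ i)) → Der Ξ Φ Γ (.tm c (C.inst .zero)) →
      Der Ξ Φ (C :: .nat :: Γ)
        (.tm d (C.tsub (scons (.succ (.var 1)) (fun k => .var (k + 2))))) →
      Der Ξ Φ Γ (.eq (.natInd C c d .zero) c (C.inst .zero))
  | natBetaSucc {Ξ : List Cube} {Φ : List Tope} {Γ : List Tm} {C c d n : Tm} {i : ℕ} :
      Der Ξ Φ (.nat :: Γ) (.tm C (.univ i)) → Der Ξ Φ Γ (.tm c (C.inst .zero)) →
      Der Ξ Φ (C :: .nat :: Γ)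
        (.tm d (C.tsub (scons (.succ (.var 1)) (fun k => .var (k + 2))))) →
      Der Ξ Φ Γ (.tm n .nat) →
      Der Ξ Φ Γ (.eq (.natInd C c d (.succ n)) (d.inst₂ n (.natInd C c d n)) (C.inst (.succ n)))
  -- elimination of `⊥` and `∨` of topes into types
  | recBot {Ξ : List Cube} {Φ : List Tope} {Γ : List Tm} {A : Tm} {i : ℕ} :
      Ent Ξ Φ .bot → Der Ξ Φ Γ (.tm A (.univ i)) → Der Ξ Φ Γ (.tm .recBot A)
  | recBotEta {Ξ : List Cube} {Φ : List Tope} {Γ : List Tm} {A a : Tm} :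
      Ent Ξ Φ .bot → Der Ξ Φ Γ (.tm a A) → Der Ξ Φ Γ (.eq a .recBot A)
  | recOr {Ξ : List Cube} {Φ : List Tope} {Γ : List Tm} {φ ψ : Tope} {A a b : Tm} {i : ℕ} :
      Ent Ξ Φ (.or φ ψ) → Der Ξ Φ Γ (.tm A (.univ i)) →
      Der Ξ (φ :: Φ) Γ (.tm a A) → Der Ξ (ψ :: Φ) Γ (.tm b A) →
      Der Ξ (.and φ ψ :: Φ) Γ (.eq a b A) →
      Der Ξ Φ Γ (.tm (.recOr φ ψ a b) A)
  | recOrCong {Ξ : List Cube} {Φ : List Tope} {Γ : List Tm} {φ ψ : Tope} {A a a' b b' : Tm}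
      {i : ℕ} :
      Ent Ξ Φ (.or φ ψ) → Der Ξ Φ Γ (.tm A (.univ i)) →
      Der Ξ (φ :: Φ) Γ (.eq a a' A) → Der Ξ (ψ :: Φ) Γ (.eq b b' A) →
      Der Ξ (.and φ ψ :: Φ) Γ (.eq a b A) →
      Der Ξ Φ Γ (.eq (.recOr φ ψ a b) (.recOr φ ψ a' b') A)
  | recOrLeft {Ξ : List Cube} {Φ : List Tope} {Γ : List Tm} {φ ψ : Tope} {A a b : Tm} {i : ℕ} :
      Ent Ξ Φ (.or φ ψ) → Der Ξ Φ Γ (.tm A (.univ i)) →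
      Der Ξ (φ :: Φ) Γ (.tm a A) → Der Ξ (ψ :: Φ) Γ (.tm b A) →
      Der Ξ (.and φ ψ :: Φ) Γ (.eq a b A) →
      Der Ξ (φ :: Φ) Γ (.eq (.recOr φ ψ a b) a A)
  | recOrRight {Ξ : List Cube} {Φ : List Tope} {Γ : List Tm} {φ ψ : Tope} {A a b : Tm}
      {i : ℕ} :
      Ent Ξ Φ (.or φ ψ) → Der Ξ Φ Γ (.tm A (.univ i)) →
      Der Ξ (φ :: Φ) Γ (.tm a A) → Der Ξ (ψ :: Φ) Γ (.tm b A) →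
      Der Ξ (.and φ ψ :: Φ) Γ (.eq a b A) →
      Der Ξ (ψ :: Φ) Γ (.eq (.recOr φ ψ a b) b A)
  | recOrEta {Ξ : List Cube} {Φ : List Tope} {Γ : List Tm} {φ ψ : Tope} {A a : Tm} :
      Ent Ξ Φ (.or φ ψ) → Der Ξ Φ Γ (.tm a A) → Der Ξ Φ Γ (.eq a (.recOr φ ψ a a) A)
  -- extension types
  | ext {Ξ : List Cube} {Φ : List Tope} {Γ : List Tm} {I : Cube} {φ ψ : Tope} {A a : Tm}
      {i : ℕ} :
      IsTope [I] φ → IsTope [I] ψ → Ent [I] [φ] ψ → Der Ξ Φ Γ .ctx →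
      Der (I :: Ξ) (ψ :: Φ.map Tope.wk) (Γ.map Tm.wkC) (.tm A (.univ i)) →
      Der (I :: Ξ) (φ :: Φ.map Tope.wk) (Γ.map Tm.wkC) (.tm a A) →
      Der Ξ Φ Γ (.tm (.ext I ψ A φ a) (.univ i))
  | extCong {Ξ : List Cube} {Φ : List Tope} {Γ : List Tm} {I : Cube} {φ ψ : Tope}
      {A A' a a' : Tm} {i : ℕ} :
      IsTope [I] φ → IsTope [I] ψ → Ent [I] [φ] ψ → Der Ξ Φ Γ .ctx →
      Der (I :: Ξ) (ψ :: Φ.map Tope.wk) (Γ.map Tm.wkC) (.eq A A' (.univ i)) →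
      Der (I :: Ξ) (φ :: Φ.map Tope.wk) (Γ.map Tm.wkC) (.eq a a' A) →
      Der Ξ Φ Γ (.eq (.ext I ψ A φ a) (.ext I ψ A' φ a') (.univ i))
  | extLam {Ξ : List Cube} {Φ : List Tope} {Γ : List Tm} {I : Cube} {φ ψ : Tope} {A a b : Tm}
      {i : ℕ} :
      Der Ξ Φ Γ (.tm (.ext I ψ A φ a) (.univ i)) →
      Der (I :: Ξ) (ψ :: Φ.map Tope.wk) (Γ.map Tm.wkC) (.tm b A) →
      Der (I :: Ξ) (φ :: Φ.map Tope.wk) (Γ.map Tm.wkC) (.eq b a A) →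
      Der Ξ Φ Γ (.tm (.extLam I ψ b) (.ext I ψ A φ a))
  | extLamCong {Ξ : List Cube} {Φ : List Tope} {Γ : List Tm} {I : Cube} {φ ψ : Tope}
      {A a b b' : Tm} {i : ℕ} :
      Der Ξ Φ Γ (.tm (.ext I ψ A φ a) (.univ i)) →
      Der (I :: Ξ) (ψ :: Φ.map Tope.wk) (Γ.map Tm.wkC) (.eq b b' A) →
      Der (I :: Ξ) (φ :: Φ.map Tope.wk) (Γ.map Tm.wkC) (.eq b a A) →
      Der Ξ Φ Γ (.eq (.extLam I ψ b) (.extLam I ψ b') (.ext I ψ A φ a))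
  | extApp {Ξ : List Cube} {Φ : List Tope} {Γ : List Tm} {I : Cube} {φ ψ : Tope} {A a f : Tm}
      {s : CTm} :
      Der Ξ Φ Γ (.tm f (.ext I ψ A φ a)) → CTy Ξ s I → Ent Ξ Φ (ψ.inst s) →
      Der Ξ Φ Γ (.tm (.extApp f s) (A.instC s))
  | extAppCong {Ξ : List Cube} {Φ : List Tope} {Γ : List Tm} {I : Cube} {φ ψ : Tope}
      {A a f f' : Tm} {s s' : CTm} :
      Der Ξ Φ Γ (.eq f f' (.ext I ψ A φ a)) → CTy Ξ s I → CTy Ξ s' I → Ent Ξ Φ (.eq s s') →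
      Ent Ξ Φ (ψ.inst s) →
      Der Ξ Φ Γ (.eq (.extApp f s) (.extApp f' s') (A.instC s))
  | extAppBoundary {Ξ : List Cube} {Φ : List Tope} {Γ : List Tm} {I : Cube} {φ ψ : Tope}
      {A a f : Tm} {s : CTm} :
      Der Ξ Φ Γ (.tm f (.ext I ψ A φ a)) → CTy Ξ s I → Ent Ξ Φ (φ.inst s) →
      Der Ξ Φ Γ (.eq (.extApp f s) (a.instC s) (A.instC s))
  | extBeta {Ξ : List Cube} {Φ : List Tope} {Γ : List Tm} {I : Cube} {φ ψ : Tope}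
      {A a b : Tm} {s : CTm} {i : ℕ} :
      Der Ξ Φ Γ (.tm (.ext I ψ A φ a) (.univ i)) →
      Der (I :: Ξ) (ψ :: Φ.map Tope.wk) (Γ.map Tm.wkC) (.tm b A) →
      Der (I :: Ξ) (φ :: Φ.map Tope.wk) (Γ.map Tm.wkC) (.eq b a A) →
      CTy Ξ s I → Ent Ξ Φ (ψ.inst s) →
      Der Ξ Φ Γ (.eq (.extApp (.extLam I ψ b) s) (b.instC s) (A.instC s))
  | extEta {Ξ : List Cube} {Φ : List Tope} {Γ : List Tm} {I : Cube} {φ ψ : Tope}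
      {A a f : Tm} :
      Der Ξ Φ Γ (.tm f (.ext I ψ A φ a)) →
      Der Ξ Φ Γ (.eq f (.extLam I ψ (.extApp f.wkC (.var 0))) (.ext I ψ A φ a))
  -- function extensionality: the canonical map from `f = g` to `∏ x, f x = g x` is an equivalence
  | funext {Ξ : List Cube} {Φ : List Tope} {Γ : List Tm} {A B f g : Tm} :
      Der Ξ Φ Γ (.tm f (.pi A B)) → Der Ξ Φ Γ (.tm g (.pi A B)) →
      Der Ξ Φ Γ (.tm (.funext A B f g)
        (Tm.isEquiv (.id (.pi A B) f g) (Tm.homotopy A B f g) (Tm.happly A B f g)))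
  | funextCong {Ξ : List Cube} {Φ : List Tope} {Γ : List Tm} {A A' B B' f f' g g' : Tm}
      {i : ℕ} :
      Der Ξ Φ Γ (.eq A A' (.univ i)) → Der Ξ Φ (A :: Γ) (.eq B B' (.univ i)) →
      Der Ξ Φ Γ (.eq f f' (.pi A B)) → Der Ξ Φ Γ (.eq g g' (.pi A B)) →
      Der Ξ Φ Γ (.eq (.funext A B f g) (.funext A' B' f' g')
        (Tm.isEquiv (.id (.pi A B) f g) (Tm.homotopy A B f g) (Tm.happly A B f g)))
  -- relative function extensionality: if every `A t` is contractible, so is the extension type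
  | relFunext {Ξ : List Cube} {Φ : List Tope} {Γ : List Tm} {I : Cube} {φ ψ : Tope}
      {A a c : Tm} {i : ℕ} :
      Der Ξ Φ Γ (.tm (.ext I ψ A φ a) (.univ i)) →
      Der (I :: Ξ) (ψ :: Φ.map Tope.wk) (Γ.map Tm.wkC) (.tm c (Tm.isContr A)) →
      Der Ξ Φ Γ (.tm (.relFunext I ψ A φ a c) (Tm.isContr (.ext I ψ A φ a)))
  | relFunextCong {Ξ : List Cube} {Φ : List Tope} {Γ : List Tm} {I : Cube} {φ ψ : Tope}
      {A A' a a' c c' : Tm} {i : ℕ} :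
      IsTope [I] φ → IsTope [I] ψ → Ent [I] [φ] ψ → Der Ξ Φ Γ .ctx →
      Der (I :: Ξ) (ψ :: Φ.map Tope.wk) (Γ.map Tm.wkC) (.eq A A' (.univ i)) →
      Der (I :: Ξ) (φ :: Φ.map Tope.wk) (Γ.map Tm.wkC) (.eq a a' A) →
      Der (I :: Ξ) (ψ :: Φ.map Tope.wk) (Γ.map Tm.wkC) (.eq c c' (Tm.isContr A)) →
      Der Ξ Φ Γ (.eq (.relFunext I ψ A φ a c) (.relFunext I ψ A' φ a' c')
        (Tm.isContr (.ext I ψ A φ a)))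

/-! ### Simplices, arrows, Segal types, covariant families -/

/-- The tope `(0 ≡ t) ∨ (t ≡ 1)` in `t : two`, i.e. the boundary of the 1-simplex. -/
def bdry1 : Tope := .or (.eq .zero (.var 0)) (.eq (.var 0) .one)

/-- The coordinate `t₁` of the last cube variable `⟨t₁, t₂⟩ : two × two`. -/
def t₁ : CTm := .fst (.var 0)

/-- The coordinate `t₂` of the last cube variable `⟨t₁, t₂⟩ : two × two`. -/
def t₂ : CTm := .snd (.var 0)

/-- The tope `t₂ ≤ t₁` in `⟨t₁, t₂⟩ : two × two`, i.e. the 2-simplex. -/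
def simplex2 : Tope := .le t₂ t₁

/-- The part `0 ≡ t₂ ≤ t₁` of the boundary of the 2-simplex. -/
def bdry2a : Tope := .and (.eq .zero t₂) (.le t₂ t₁)

/-- The part `t₂ ≡ t₁` of the boundary of the 2-simplex. -/
def bdry2b : Tope := .eq t₂ t₁

/-- The part `t₂ ≤ t₁ ≡ 1` of the boundary of the 2-simplex. -/
def bdry2c : Tope := .and (.le t₂ t₁) (.eq t₁ .one)

/-- The boundary of the 2-simplex. -/
def bdry2 : Tope := .or bdry2a (.or bdry2b bdry2c)

namespace Tm

/-- The term `[x, y]` over the boundary of the 1-simplex: `x` at `0` and `y` at `1`. -/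
def ends (x y : Tm) : Tm := recOr (.eq .zero (.var 0)) (.eq (.var 0) .one) x.wkC y.wkC

/-- The type `hom_A(x, y)` of functions `two → A` that are judgmentally `x` at `0` and `y` at
`1`. -/
def hom (A x y : Tm) : Tm := ext .two .top A.wkC bdry1 (ends x y)

/-- The identity arrow of `x`: the constant function on `two` with value `x`. -/
def idArr (x : Tm) : Tm := extLam .two .top x.wkC

/-- The type `hom²_A(x, y, z, f, g, h)` of functions `f' ⟨t₁, t₂⟩` on the 2-simplex with
`f' ⟨t, 0⟩ ≡ f t`, `f' ⟨1, t⟩ ≡ g t` and `f' ⟨t, t⟩ ≡ h t`.  (The end points are determined by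
`f`, `g`, `h`.) -/
def hom2 (A f g h : Tm) : Tm :=
  ext (.prod .two .two) simplex2 A.wkC bdry2
    (recOr bdry2a (.or bdry2b bdry2c) (extApp f.wkC t₁)
      (recOr bdry2b bdry2c (extApp h.wkC t₁) (extApp g.wkC t₂)))

/-- `A` is a Segal type:
`∏ (x y z : A) (f : hom_A(x, y)) (g : hom_A(y, z)),`
`  isContr (∑ (h : hom_A(x, z)), hom²_A(x, y, z, f, g, h))`. -/
def isSegal (A : Tm) : Tm :=
  pi A (pi (A.wkN 1) (pi (A.wkN 2)
    (pi (hom (A.wkN 3) (var 2) (var 1))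
      (pi (hom (A.wkN 4) (var 2) (var 1))
        (isContr (sigma (hom (A.wkN 5) (var 4) (var 2))
          (hom2 (A.wkN 6) (var 2) (var 1) (var 0))))))))

/-- The type `hom_{C(f)}(u, v)` of arrows from `u` to `v` over `f`, for a function `C` from a type
to a universe: the functions that send `t : two` to an element of `C (f t)` and are judgmentally
`u` at `0` and `v` at `1`. -/
def dhom (C f u v : Tm) : Tm :=
  ext .two .top (app C.wkC (extApp f.wkC (.var 0))) bdry1 (ends u v)

/-- The type family `C : A → univ` is covariant:
`∏ (x y : A) (f : hom_A(x, y)) (u : C x), isContr (∑ (v : C y), hom_{C(f)}(u, v))`. -/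
def isCovariant (A C : Tm) : Tm :=
  pi A (pi (A.wkN 1)
    (pi (hom (A.wkN 2) (var 1) (var 0))
      (pi (app (C.wkN 3) (var 2))
        (isContr (sigma (app (C.wkN 4) (var 2))
          (dhom (C.wkN 5) (var 2) (var 1) (var 0)))))))

/-- `∑ (x : A), hom_A(a, x)`. -/
def coslice (A a : Tm) : Tm := sigma A (hom A.wk a.wk (var 0))

/-- The type `∏ (x : A), hom_A(a, x) → univ j` of families over `x : A` and `f : hom_A(a, x)`. -/
def famType (A a : Tm) (j : ℕ) : Tm := pi A (pi (hom A.wk a.wk (var 0)) (univ j))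

/-- The uncurried version `λ (z : ∑ (x : A), hom_A(a, x)), C (fst z) (snd z)` of such a family. -/
def uncurry (A a C : Tm) : Tm :=
  lam (coslice A a) (app (app C.wk (fst (var 0))) (snd (var 0)))

/-- The type `∏ (x : A) (f : hom_A(a, x)), C x f` of sections of such a family. -/
def sections (A a C : Tm) : Tm :=
  pi A (pi (hom A.wk a.wk (var 0)) (app (app (C.wkN 2) (var 1)) (var 0)))

/-- The type `C a id_a`. -/
def fiberAtId (a C : Tm) : Tm := app (app C a) (idArr a)

/-- Evaluation at the identity, `λ (s : ∏ (x : A) (f : hom_A(a, x)), C x f), s a id_a`. -/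
def evid (A a C : Tm) : Tm := lam (sections A a C) (app (app (var 0) a.wk) (idArr a.wk))

end Tm

end STT

/-! The pair `(a, id_a)` is initial in the coslice `∑ x, hom_A(a, x)`, and strictly so. For `f :
hom_A(a, x)` the function `t ↦ (f t, r ↦ f (min r t))` is an arrow from `(a, id_a)` to `(x, f)`. Its
end points are judgmentally right, and for `f = id_a` it is judgmentally constant. The minimum is
not a cube term. Since `≤` is total, `f (min r t)` is glued from `f r` on `r ≤ t` and `f t` on `t ≤
r`, which agree where `r ≡ t` by antisymmetry. This is `Tm.conn`; the arrow in the coslice is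
`Tm.coneArr`.

The inverse `Tm.yon` of the evaluation sends `u : C(a, id_a)` to the section whose value at `(x, f)`
is the end point of the lift of `coneArr f` starting at `u` that covariance provides. Covariance
makes the type of such lifts contractible, so any lift from `u` to `v` gives a path from the chosen
end point to `v` (`Der.coneLift_path`). Two explicit lifts then suffice.

Over the constant arrow `coneArr id_a`, the constant function `u` is a lift, so the new section has
value `u` at the identity up to a path (`Der.coneLift_idArr_path`). For a section `φ`, the function
`t ↦ φ (f t) (r ↦ f (min r t))` is a lift from `φ a id_a` to `φ x f`, so `φ` agrees pointwise with
the section built from `φ a id_a` (`Der.coneLift_sections_path`). Function extensionality, applied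
twice, turns this into a path of sections.

The remaining work is syntactic: raw substitutions compose, weakening and cut follow from the
general substitution rule, and boundary conditions and conversions are checked as judgmental
equalities. -/

namespace STT

/-! ### Substitution calculus of raw expressions -/

@[simp] theorem scons_zero {α : Type} (a : α) (σ : ℕ → α) : scons a σ 0 = a := rfl

@[simp] theorem scons_succ {α : Type} (a : α) (σ : ℕ → α) (k : ℕ) : scons a σ (k + 1) = σ k := rfl

@[simp] theorem upr_zero (r : ℕ → ℕ) : upr r 0 = 0 := rfl

@[simp] theorem upr_succ (r : ℕ → ℕ) (k : ℕ) : upr r (k + 1) = r k + 1 := rfl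

namespace CTm

theorem ren_eq_sub (r : ℕ → ℕ) (s : CTm) : s.ren r = s.sub (fun k => var (r k)) := by
  induction s <;> simp_all [ren, sub]

theorem sub_var (s : CTm) : s.sub var = s := by
  induction s <;> simp_all [sub]

theorem sub_sub (ρ ρ' : ℕ → CTm) (s : CTm) :
    (s.sub ρ).sub ρ' = s.sub (fun k => (ρ k).sub ρ') := by
  induction s <;> simp_all [sub]

theorem up_var : up var = var := by
  funext k; cases k <;> rfl

theorem up_comp (ρ ρ' : ℕ → CTm) : (fun k => (up ρ k).sub (up ρ')) = up (fun k => (ρ k).sub ρ') := by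
  funext k; cases k
  · rfl
  · simp only [up, scons_succ, ren_eq_sub, sub_sub, sub]

theorem up_ren (r : ℕ → ℕ) : (fun k => var (upr r k)) = up (fun k => var (r k)) := by
  funext k; cases k <;> rfl

end CTm

namespace Tope

theorem ren_eq_sub (r : ℕ → ℕ) (φ : Tope) : φ.ren r = φ.sub (fun k => .var (r k)) := by
  induction φ <;> simp_all [ren, sub, CTm.ren_eq_sub]

theorem sub_var (φ : Tope) : φ.sub CTm.var = φ := by
  induction φ <;> simp_all [sub, CTm.sub_var]

theorem sub_sub (ρ ρ' : ℕ → CTm) (φ : Tope) :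
    (φ.sub ρ).sub ρ' = φ.sub (fun k => (ρ k).sub ρ') := by
  induction φ <;> simp_all [sub, CTm.sub_sub]

end Tope

namespace Tm

theorem up_ren (q : ℕ → ℕ) : (fun k => var (upr q k)) = up (fun k => var (q k)) := by
  funext k; cases k <;> rfl

theorem upC_ren (q : ℕ → ℕ) : upC (fun k => var (q k)) = (fun k => var (q k)) := rfl

theorem ren_eq_sub (a : Tm) : ∀ r q : ℕ → ℕ,
    a.ren r q = a.sub (fun k => .var (r k)) (fun k => var (q k)) := by
  induction a <;> intro r q <;>
    simp_all only [ren, sub, up_ren, upC_ren, CTm.up_ren, CTm.ren_eq_sub, Tope.ren_eq_sub]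

theorem up_var : up var = var := by
  funext k; cases k <;> rfl

theorem upC_var : upC var = var := rfl

theorem sub_var (a : Tm) : a.sub CTm.var var = a := by
  induction a <;>
    simp_all only [sub, up_var, upC_var, CTm.up_var, CTm.sub_var, Tope.sub_var]

theorem up_ren_comp (q : ℕ → ℕ) (σ : ℕ → Tm) : (fun k => up σ (upr q k)) = up (fun k => σ (q k)) := by
  funext k; cases k <;> rfl

theorem upC_ren_comp (q : ℕ → ℕ) (σ : ℕ → Tm) : (fun k => upC σ (q k)) = upC (fun k => σ (q k)) :=
  rfl

theorem _root_.STT.CTm.up_ren_comp (q : ℕ → ℕ) (σ : ℕ → CTm) :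
    (fun k => CTm.up σ (upr q k)) = CTm.up (fun k => σ (q k)) := by
  funext k; cases k <;> rfl

theorem _root_.STT.CTm.ren_sub (r : ℕ → ℕ) (ρ : ℕ → CTm) (s : CTm) :
    (s.ren r).sub ρ = s.sub (fun k => ρ (r k)) := by
  rw [CTm.ren_eq_sub, CTm.sub_sub]; rfl

theorem _root_.STT.Tope.ren_sub (r : ℕ → ℕ) (ρ : ℕ → CTm) (s : Tope) :
    (s.ren r).sub ρ = s.sub (fun k => ρ (r k)) := by
  rw [Tope.ren_eq_sub, Tope.sub_sub]; rfl

/-- `up` and `upC` weaken by renaming, so composition of substitutions is reached in stages: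
renaming then substitution here, substitution then renaming in `sub_ren`, two substitutions in
`sub_sub`. Passing under a binder at each stage uses the previous one. -/
theorem ren_sub (a : Tm) : ∀ (r q : ℕ → ℕ) (ρ : ℕ → CTm) (σ : ℕ → Tm),
    (a.ren r q).sub ρ σ = a.sub (fun k => ρ (r k)) (fun k => σ (q k)) := by
  induction a <;> intro r q ρ σ <;>
    simp_all only [ren, sub, up_ren_comp, upC_ren_comp, CTm.up_ren_comp, CTm.ren_sub, Tope.ren_sub]

theorem ren_ren (a : Tm) (r q r' q' : ℕ → ℕ) :
    (a.ren r q).ren r' q' = a.ren (fun k => r' (r k)) (fun k => q' (q k)) := by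
  rw [ren_eq_sub _ r', ren_sub, ren_eq_sub]

theorem up_comp_ren (r q : ℕ → ℕ) (σ : ℕ → Tm) :
    (fun k => (up σ k).ren r (upr q)) = up (fun k => (σ k).ren r q) := by
  funext k; cases k
  · rfl
  · simp only [up, scons_succ, wk, wkN, ren_ren]; rfl

theorem upC_comp_ren (r q : ℕ → ℕ) (σ : ℕ → Tm) :
    (fun k => (upC σ k).ren (upr r) q) = upC (fun k => (σ k).ren r q) := by
  funext k
  simp only [upC, wkC, ren_ren]; rfl

theorem _root_.STT.CTm.sub_ren (r : ℕ → ℕ) (ρ : ℕ → CTm) (s : CTm) :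
    (s.sub ρ).ren r = s.sub (fun k => (ρ k).ren r) := by
  simp only [CTm.ren_eq_sub, CTm.sub_sub]

theorem _root_.STT.Tope.sub_ren (r : ℕ → ℕ) (ρ : ℕ → CTm) (s : Tope) :
    (s.sub ρ).ren r = s.sub (fun k => (ρ k).ren r) := by
  simp only [Tope.ren_eq_sub, Tope.sub_sub, CTm.ren_eq_sub]

theorem _root_.STT.CTm.up_comp_ren (r : ℕ → ℕ) (ρ : ℕ → CTm) :
    (fun k => (CTm.up ρ k).ren (upr r)) = CTm.up (fun k => (ρ k).ren r) := by
  funext k; cases k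
  · rfl
  · simp only [CTm.up, scons_succ, CTm.ren_eq_sub, CTm.sub_sub]; rfl

theorem sub_ren (a : Tm) : ∀ (r q : ℕ → ℕ) (ρ : ℕ → CTm) (σ : ℕ → Tm),
    (a.sub ρ σ).ren r q = a.sub (fun k => (ρ k).ren r) (fun k => (σ k).ren r q) := by
  induction a <;> intro r q ρ σ <;>
    simp_all only [ren, sub, up_comp_ren, upC_comp_ren, CTm.up_comp_ren, CTm.sub_ren, Tope.sub_ren]

theorem up_comp (ρ : ℕ → CTm) (σ σ' : ℕ → Tm) :
    (fun k => (up σ k).sub ρ (up σ')) = up (fun k => (σ k).sub ρ σ') := by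
  funext k; cases k
  · rfl
  · simp only [up, scons_succ, wk, wkN, ren_sub, sub_ren]
    congr 1
    funext k
    simp only [CTm.ren_eq_sub]
    exact (CTm.sub_var _).symm

theorem upC_comp (ρ : ℕ → CTm) (σ σ' : ℕ → Tm) :
    (fun k => (upC σ k).sub (CTm.up ρ) (upC σ')) = upC (fun k => (σ k).sub ρ σ') := by
  funext k
  simp only [upC, wkC, ren_sub, sub_ren]; rfl

theorem sub_sub (a : Tm) : ∀ (ρ ρ' : ℕ → CTm) (σ σ' : ℕ → Tm),
    (a.sub ρ σ).sub ρ' σ' = a.sub (fun k => (ρ k).sub ρ') (fun k => (σ k).sub ρ' σ') := by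
  induction a <;> intro ρ ρ' σ σ' <;>
    simp_all only [sub, up_comp, upC_comp, CTm.up_comp, CTm.sub_sub, Tope.sub_sub]

theorem sub_eq_self {a : Tm} {ρ : ℕ → CTm} {σ : ℕ → Tm} (h : ∀ k, ρ k = .var k)
    (h' : ∀ k, σ k = var k) : a.sub ρ σ = a := by
  rw [_root_.funext h, _root_.funext h']; exact sub_var a

theorem wkN_eq_sub (n : ℕ) (a : Tm) : a.wkN n = a.sub CTm.var (fun k => var (k + n)) :=
  ren_eq_sub _ _ _

theorem wk_eq_sub (a : Tm) : a.wk = a.sub CTm.var (fun k => var (k + 1)) :=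
  ren_eq_sub _ _ _

theorem wkC_eq_sub (a : Tm) : a.wkC = a.sub (fun k => .var (k + 1)) var :=
  ren_eq_sub _ _ _

/-- The topes of an extension type mention only its own bound variable, so a substitution leaves the
boundary alone and acts on the type and the end points. -/
theorem hom_sub (ρ : ℕ → CTm) (σ : ℕ → Tm) (A x y : Tm) :
    (hom A x y).sub ρ σ = hom (A.sub ρ σ) (x.sub ρ σ) (y.sub ρ σ) := by
  simp only [hom, ends, sub, wkC, ren_sub, sub_ren, bdry1, Tope.sub, CTm.sub]; rfl

theorem idArr_sub (ρ : ℕ → CTm) (σ : ℕ → Tm) (x : Tm) :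
    (idArr x).sub ρ σ = idArr (x.sub ρ σ) := by
  simp only [idArr, sub, wkC, ren_sub, sub_ren]; rfl

theorem coslice_sub (ρ : ℕ → CTm) (σ : ℕ → Tm) (A a : Tm) :
    (coslice A a).sub ρ σ = coslice (A.sub ρ σ) (a.sub ρ σ) := by
  simp only [coslice, sub, hom_sub, wk, wkN, ren_sub, sub_ren, up, scons_succ, scons_zero]
  have h : (fun k => (ρ k).ren _root_.id) = ρ := by
    funext k; rw [CTm.ren_eq_sub]; exact CTm.sub_var _
  simp only [h]; rfl

-- With these equations every renaming, weakening and instantiation becomes part of a single `sub`,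
-- so that two presentations of the same substituted term have a common normal form.
attribute [simp] CTm.ren_eq_sub CTm.sub_sub CTm.sub CTm.up Tope.ren_eq_sub Tope.sub_sub Tope.sub
  Tope.wk Tope.inst ren_eq_sub sub_sub sub_var sub up upC wkN_eq_sub wk_eq_sub wkC_eq_sub hom_sub
  idArr_sub coslice_sub inst inst₂ instC tsub CTm.sub_var Tope.sub_var

end Tm

/-! ### Admissible rules: well-formed contexts, weakening, cut -/

theorem CTy.sub {Ξ Ξ' : List Cube} {s : CTm} {I : Cube} (h : CTy Ξ s I) {ρ : ℕ → CTm}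
    (hρ : ∀ k I, Ξ[k]? = some I → CTy Ξ' (ρ k) I) : CTy Ξ' (s.sub ρ) I := by
  induction h with
  | var h => exact hρ _ _ h
  | star => exact .star
  | pair _ _ h₁ h₂ => exact .pair h₁ h₂
  | fst _ h => exact .fst h
  | snd _ h => exact .snd h
  | zero => exact .zero
  | one => exact .one

theorem IsTope.sub {Ξ Ξ' : List Cube} {φ : Tope} (h : IsTope Ξ φ) {ρ : ℕ → CTm}
    (hρ : ∀ k I, Ξ[k]? = some I → CTy Ξ' (ρ k) I) : IsTope Ξ' (φ.sub ρ) := by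
  induction h with
  | top => exact .top
  | bot => exact .bot
  | and _ _ h₁ h₂ => exact .and h₁ h₂
  | or _ _ h₁ h₂ => exact .or h₁ h₂
  | eq h₁ h₂ => exact .eq (h₁.sub hρ) (h₂.sub hρ)
  | le h₁ h₂ => exact .le (h₁.sub hρ) (h₂.sub hρ)

theorem IsTope.wk {Ξ : List Cube} {φ : Tope} {I : Cube} (h : IsTope Ξ φ) :
    IsTope (I :: Ξ) φ.wk := by
  rw [Tope.wk, Tope.ren_eq_sub]
  exact h.sub fun k J hk => .var hk

namespace Der

/-- The context of a derivable judgment is well formed. -/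
theorem wf {Ξ : List Cube} {Φ : List Tope} {Γ : List Tm} {j : Jdg} (h : Der Ξ Φ Γ j) :
    Der Ξ Φ Γ .ctx := by
  induction h <;> first
    | assumption
    | (constructor <;> assumption)

/-- The equations for the judgment and the context keep the indices free for induction. Besides the
two formation rules only `subst` can conclude `.ctx`, and then the same judgment is one of its
premises. -/
theorem ctx_cons_inv {Ξ : List Cube} {Φ : List Tope} {Γ Δ : List Tm} {A : Tm} {j : Jdg}
    (h : Der Ξ Φ Δ j) (hj : j = .ctx) (hΔ : Δ = A :: Γ) :
    Der Ξ Φ Γ .ctx ∧ ∃ i, Der Ξ Φ Γ (.tm A (.univ i)) := by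
  induction h with
  | ctxNil => cases hΔ
  | ctxCons h h' => cases hΔ; exact ⟨h, _, h'⟩
  | subst _ _ _ _ _ _ ih => exact ih rfl hΔ
  | _ => cases hj

theorem ctx_cons_iff {Ξ : List Cube} {Φ : List Tope} {Γ : List Tm} {A : Tm} :
    Der Ξ Φ (A :: Γ) .ctx ↔ Der Ξ Φ Γ .ctx ∧ ∃ i, Der Ξ Φ Γ (.tm A (.univ i)) :=
  ⟨fun h => ctx_cons_inv h rfl rfl, fun ⟨h, _, h'⟩ => .ctxCons h h'⟩

/-- Well-formedness of topes is recorded only when the empty context is formed, so the types are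
stripped off first. -/
theorem ctx_topes {Ξ : List Cube} {Φ : List Tope} {Γ : List Tm} {j : Jdg}
    (h : Der Ξ Φ Γ j) : ∀ φ ∈ Φ, IsTope Ξ φ := by
  have : ∀ Γ, Der Ξ Φ Γ .ctx → Der Ξ Φ [] .ctx := by
    intro Γ h
    induction Γ with
    | nil => exact h
    | cons A Γ ih => exact ih (ctx_cons_iff.1 h).1
  have h' := this Γ h.wf
  generalize hj : Jdg.ctx = j, hΓ : ([] : List Tm) = Γ at h'
  clear h this
  induction h' with
  | ctxNil h => exact h
  | ctxCons => cases hΓ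
  | subst _ _ _ _ _ _ ih => exact ih rfl hΓ
  | _ => cases hj

/-- Change of cube and tope context along a cube substitution. -/
theorem ctx_sub {Ξ Ξ' : List Cube} {Φ Φ' : List Tope} {Γ : List Tm} {ρ : ℕ → CTm}
    (h : Der Ξ Φ Γ .ctx) (hΦ' : ∀ φ ∈ Φ', IsTope Ξ' φ)
    (hρ : ∀ k I, Ξ[k]? = some I → CTy Ξ' (ρ k) I) (hΦ : ∀ φ ∈ Φ, Ent Ξ' Φ' (φ.sub ρ)) :
    Der Ξ' Φ' (Γ.map fun A => A.sub ρ Tm.var) .ctx := by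
  induction Γ with
  | nil => exact .ctxNil hΦ'
  | cons A Γ ih =>
    obtain ⟨h, i, hA⟩ := ctx_cons_iff.1 h
    refine .ctxCons (i := i) (ih h) ?_
    refine Der.subst (j := .tm A (.univ i)) hA (ih h) hρ hΦ ?_
    intro k B hk
    have := Der.var (k := k) (A := B.sub ρ Tm.var) (ih h) (by simp [hk])
    simpa only [Tm.wkN, Tm.sub_ren, Tm.ren_sub, CTm.ren_eq_sub, CTm.sub_var, Tm.ren, _root_.id,
      show (fun k => CTm.var k) = CTm.var from rfl] using this

theorem subC {Ξ Ξ' : List Cube} {Φ Φ' : List Tope} {Γ : List Tm} {j : Jdg} {ρ : ℕ → CTm}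
    (h : Der Ξ Φ Γ j) (hΦ' : ∀ φ ∈ Φ', IsTope Ξ' φ)
    (hρ : ∀ k I, Ξ[k]? = some I → CTy Ξ' (ρ k) I) (hΦ : ∀ φ ∈ Φ, Ent Ξ' Φ' (φ.sub ρ)) :
    Der Ξ' Φ' (Γ.map fun A => A.sub ρ Tm.var) (j.sub ρ Tm.var) := by
  refine h.subst (ctx_sub h.wf hΦ' hρ hΦ) hρ hΦ ?_
  intro k B hk
  have := Der.var (k := k) (A := B.sub ρ Tm.var) (ctx_sub h.wf hΦ' hρ hΦ) (by simp [hk])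
  simpa only [Tm.wkN, Tm.sub_ren, Tm.ren_sub, CTm.ren_eq_sub, CTm.sub_var, Tm.ren, _root_.id,
      show (fun k => CTm.var k) = CTm.var from rfl] using this

end Der

theorem Jdg.sub_var (j : Jdg) : j.sub CTm.var Tm.var = j := by
  cases j <;> simp only [Jdg.sub, Tm.sub_var]

namespace Der

/-- Cut for topes. -/
theorem cut {Ξ : List Cube} {Φ Φ' : List Tope} {Γ : List Tm} {j : Jdg}
    (h : Der Ξ Φ Γ j) (hΦ' : ∀ φ ∈ Φ', IsTope Ξ φ) (hΦ : ∀ φ ∈ Φ, Ent Ξ Φ' φ) :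
    Der Ξ Φ' Γ j := by
  have := h.subC hΦ' (ρ := CTm.var) (fun k I hk => .var hk)
    (fun φ hφ => by rw [Tope.sub_var]; exact hΦ φ hφ)
  simpa only [Tm.sub_var, List.map_id', Jdg.sub_var] using this

theorem tope {Ξ : List Cube} {Φ : List Tope} {Γ : List Tm} {j : Jdg} {φ : Tope}
    (h : Der Ξ Φ Γ j) (hφ : IsTope Ξ φ) : Der Ξ (φ :: Φ) Γ j :=
  h.cut (List.forall_mem_cons.2 ⟨hφ, h.ctx_topes⟩)
    fun _ hψ => .hyp (List.mem_cons_of_mem _ hψ)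

theorem cutCons {Ξ : List Cube} {Φ : List Tope} {Γ : List Tm} {j : Jdg} {φ ψ : Tope}
    (h : Der Ξ (φ :: Φ) Γ j) (hψ : IsTope Ξ ψ) (hφ : Ent Ξ (ψ :: Φ) φ) : Der Ξ (ψ :: Φ) Γ j :=
  h.cut (List.forall_mem_cons.2 ⟨hψ, fun χ hχ => h.ctx_topes χ (List.mem_cons_of_mem _ hχ)⟩)
    (List.forall_mem_cons.2 ⟨hφ, fun _ h => .hyp (List.mem_cons_of_mem _ h)⟩)

/-- Weakening by a cube variable and a tope. -/
theorem wkC {Ξ : List Cube} {Φ : List Tope} {Γ : List Tm} {j : Jdg} {I : Cube} {ψ : Tope}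
    (h : Der Ξ Φ Γ j) (hψ : IsTope (I :: Ξ) ψ) :
    Der (I :: Ξ) (ψ :: Φ.map Tope.wk) (Γ.map Tm.wkC)
      (j.sub (fun k => .var (k + 1)) Tm.var) := by
  have := h.subC (ρ := fun k => .var (k + 1)) (Ξ' := I :: Ξ) (Φ' := ψ :: Φ.map Tope.wk)
    (List.forall_mem_cons.2 ⟨hψ, List.forall_mem_map.2 fun φ hφ => (h.ctx_topes φ hφ).wk⟩)
    (fun k I hk => .var hk)
    (fun φ hφ => .hyp (List.mem_cons_of_mem _ (List.mem_map.2 ⟨φ, hφ, Tope.ren_eq_sub _ _⟩)))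
  rwa [show (fun A : Tm => A.sub (fun k => .var (k + 1)) Tm.var) = Tm.wkC from
    _root_.funext fun A => (Tm.ren_eq_sub A _ _).symm] at this

theorem tm_wkC {Ξ : List Cube} {Φ : List Tope} {Γ : List Tm} {a A : Tm} {I : Cube} {ψ : Tope}
    (h : Der Ξ Φ Γ (.tm a A)) (hψ : IsTope (I :: Ξ) ψ) :
    Der (I :: Ξ) (ψ :: Φ.map Tope.wk) (Γ.map Tm.wkC) (.tm a.wkC A.wkC) := by
  have := h.wkC hψ
  rwa [Jdg.sub, ← Tm.wkC_eq_sub, ← Tm.wkC_eq_sub] at this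

theorem eq_wkC {Ξ : List Cube} {Φ : List Tope} {Γ : List Tm} {a b A : Tm} {I : Cube} {ψ : Tope}
    (h : Der Ξ Φ Γ (.eq a b A)) (hψ : IsTope (I :: Ξ) ψ) :
    Der (I :: Ξ) (ψ :: Φ.map Tope.wk) (Γ.map Tm.wkC) (.eq a.wkC b.wkC A.wkC) := by
  have := h.wkC hψ
  rwa [Jdg.sub, ← Tm.wkC_eq_sub, ← Tm.wkC_eq_sub, ← Tm.wkC_eq_sub] at this

/-- Substitution of a cube term for the last cube variable. -/
theorem instC {Ξ : List Cube} {Φ : List Tope} {Γ : List Tm} {j : Jdg} {I : Cube} {ψ : Tope}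
    {s : CTm} (h : Der (I :: Ξ) (ψ :: Φ.map Tope.wk) (Γ.map Tm.wkC) j) (hΓ : Der Ξ Φ Γ .ctx)
    (hs : CTy Ξ s I) (hψ : Ent Ξ Φ (ψ.inst s)) :
    Der Ξ Φ Γ (j.sub (scons s CTm.var) Tm.var) := by
  have := h.subC (ρ := scons s CTm.var) (Ξ' := Ξ) (Φ' := Φ) hΓ.ctx_topes
    (by rintro (_ | k) J hk
        · cases hk; exact hs
        · exact .var hk)
    (List.forall_mem_cons.2 ⟨hψ, List.forall_mem_map.2 fun φ hφ => by
      rw [Tope.wk, Tope.ren_sub]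
      exact (Tope.sub_var φ).symm ▸ .hyp hφ⟩)
  rwa [List.map_map, show ((fun A : Tm => A.sub (scons s CTm.var) Tm.var) ∘ Tm.wkC) = _root_.id from
    _root_.funext fun A => by
      rw [Function.comp, Tm.wkC, Tm.ren_sub]; exact Tm.sub_var A, List.map_id] at this

/-- Weakening by a variable. -/
theorem wk {Ξ : List Cube} {Φ : List Tope} {Γ : List Tm} {j : Jdg} {B : Tm} {i : ℕ}
    (h : Der Ξ Φ Γ j) (hB : Der Ξ Φ Γ (.tm B (.univ i))) :
    Der Ξ Φ (B :: Γ) (j.sub CTm.var (fun k => .var (k + 1))) := by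
  have hΓ : Der Ξ Φ (B :: Γ) .ctx := .ctxCons h.wf hB
  refine h.subst hΓ (fun k I hk => .var hk) (fun φ hφ => ?_) (fun k A hk => ?_)
  · rw [Tope.sub_var]; exact .hyp hφ
  · have := Der.var (k := k + 1) (A := A) hΓ hk
    rw [Tm.wkN, Tm.ren_sub]
    rwa [Tm.wkN, Tm.ren_eq_sub] at this

theorem tm_wk {Ξ : List Cube} {Φ : List Tope} {Γ : List Tm} {a A B : Tm} {i : ℕ}
    (h : Der Ξ Φ Γ (.tm a A)) (hB : Der Ξ Φ Γ (.tm B (.univ i))) :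
    Der Ξ Φ (B :: Γ) (.tm a.wk A.wk) := by
  have := h.wk hB
  rwa [Jdg.sub, ← Tm.wk_eq_sub, ← Tm.wk_eq_sub] at this

theorem cumul_le {Ξ : List Cube} {Φ : List Tope} {Γ : List Tm} {A : Tm} {i j : ℕ}
    (h : Der Ξ Φ Γ (.tm A (.univ i))) (hij : i ≤ j) : Der Ξ Φ Γ (.tm A (.univ j)) := by
  induction hij with
  | refl => exact h
  | step _ ih => exact ih.cumul

theorem var₀ {Ξ : List Cube} {Φ : List Tope} {Γ : List Tm} {A : Tm} {i : ℕ}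
    (h : Der Ξ Φ Γ (.tm A (.univ i))) : Der Ξ Φ (A :: Γ) (.tm (.var 0) A.wk) :=
  .var (.ctxCons h.wf h) rfl

/-- Terms are judgmentally equal if they are so on both parts of a disjunction of topes. -/
theorem eq_of_or {Ξ : List Cube} {Φ : List Tope} {Γ : List Tm} {φ ψ : Tope} {A a b : Tm} {i : ℕ}
    (h : Ent Ξ Φ (.or φ ψ)) (hφ : IsTope Ξ φ) (hψ : IsTope Ξ ψ)
    (hA : Der Ξ Φ Γ (.tm A (.univ i))) (ha : Der Ξ Φ Γ (.tm a A))
    (hb : Der Ξ Φ Γ (.tm b A)) (h₁ : Der Ξ (φ :: Φ) Γ (.eq a b A))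
    (h₂ : Der Ξ (ψ :: Φ) Γ (.eq a b A)) : Der Ξ Φ Γ (.eq a b A) :=
  -- By η the two terms are `recOr φ ψ a a` and `recOr φ ψ b b`. Congruence compares these branch by
  -- branch, and on the overlap only `a ≡ a` is required.
  (ha.recOrEta h).eqTrans <|
    (Der.recOrCong h hA h₁ h₂ (ha.tope (.and hφ hψ)).eqRefl).eqTrans (hb.recOrEta h).eqSymm

theorem eq_of_bot {Ξ : List Cube} {Φ : List Tope} {Γ : List Tm} {A a b : Tm}
    (h : Ent Ξ Φ .bot) (ha : Der Ξ Φ Γ (.tm a A)) (hb : Der Ξ Φ Γ (.tm b A)) :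
    Der Ξ Φ Γ (.eq a b A) :=
  (ha.recBotEta h).eqTrans (hb.recBotEta h).eqSymm

end Der

/-! ### Arrow types with prescribed end points -/

/-- The extension type of functions on `two` with values in `T`, which binds a cube variable, that
are judgmentally `x` at `0` and `y` at `1`. -/
def Tm.arr (T x y : Tm) : Tm := .ext .two .top T bdry1 (.ends x y)

theorem isTope_left {Ξ : List Cube} : IsTope (.two :: Ξ) (.eq .zero (.var 0)) :=
  .eq .zero (.var rfl)

theorem isTope_right {Ξ : List Cube} : IsTope (.two :: Ξ) (.eq (.var 0) .one) :=
  .eq (.var rfl) .one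

theorem isTope_bdry1 {Ξ : List Cube} : IsTope (.two :: Ξ) bdry1 :=
  .or isTope_left isTope_right

/-- The premises of the formation of `arr T x y`. -/
structure ArrTy (Ξ : List Cube) (Φ : List Tope) (Γ : List Tm) (i : ℕ) (T x y : Tm) : Prop where
  wf : Der Ξ Φ Γ .ctx
  ty : Der (.two :: Ξ) (.top :: Φ.map Tope.wk) (Γ.map Tm.wkC) (.tm T (.univ i))
  src : Der (.two :: Ξ) (.eq .zero (.var 0) :: Φ.map Tope.wk) (Γ.map Tm.wkC) (.tm x.wkC T)
  tgt : Der (.two :: Ξ) (.eq (.var 0) .one :: Φ.map Tope.wk) (Γ.map Tm.wkC) (.tm y.wkC T)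

namespace Der

theorem of_top {Ξ : List Cube} {Φ : List Tope} {Γ : List Tm} {j : Jdg} {φ : Tope}
    (h : Der Ξ (.top :: Φ) Γ j) (hφ : IsTope Ξ φ) : Der Ξ (φ :: Φ) Γ j :=
  h.cutCons hφ .top

/-- `recOr` types its branches over the ambient topes, which over the boundary include `bdry1`,
while `ArrTy` states the end points without it. This lemma inserts the tope; `drop₁` removes it
again when it is implied. -/
theorem tope₁ {Ξ : List Cube} {Φ : List Tope} {Γ : List Tm} {j : Jdg} {φ ψ : Tope}
    (h : Der Ξ (φ :: Φ) Γ j) (hψ : IsTope Ξ ψ) : Der Ξ (φ :: ψ :: Φ) Γ j := by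
  have := h.ctx_topes
  refine h.cut ?_ ?_
  · intro χ hχ
    simp only [List.mem_cons] at hχ this
    rcases hχ with rfl | rfl | hχ
    exacts [this _ (.inl rfl), hψ, this _ (.inr hχ)]
  · intro χ hχ
    refine .hyp ?_
    simp only [List.mem_cons] at hχ ⊢
    tauto

theorem drop₁ {Ξ : List Cube} {Φ : List Tope} {Γ : List Tm} {j : Jdg} {φ ψ : Tope}
    (h : Der Ξ (φ :: ψ :: Φ) Γ j) (hψ : Ent Ξ (φ :: Φ) ψ) : Der Ξ (φ :: Φ) Γ j := by
  have := h.ctx_topes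
  refine h.cut ?_ ?_
  · intro χ hχ
    simp only [List.mem_cons] at hχ this
    exact this _ (by tauto)
  · intro χ hχ
    simp only [List.mem_cons] at hχ
    rcases hχ with rfl | rfl | hχ
    exacts [.hyp (by simp), hψ, .hyp (by simp [hχ])]

end Der

theorem ent_left_right_bot {Ξ : List Cube} {Φ : List Tope} {s : CTm}
    (h : Ent Ξ Φ (.and (.eq .zero s) (.eq s .one))) : Ent Ξ Φ .bot :=
  .zeroNeOne (h.andLeft.eqTrans h.andRight)

namespace ArrTy

variable {Ξ : List Cube} {Φ : List Tope} {Γ : List Tm} {i : ℕ} {T x y f : Tm}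

/-- The two ends overlap only where `0 ≡ 1`. That is inconsistent, so any two elements agree there.
-/
theorem ends_prem (h : ArrTy Ξ Φ Γ i T x y) :
    Der (.two :: Ξ) (.and (.eq .zero (.var 0)) (.eq (.var 0) .one) :: bdry1 :: Φ.map Tope.wk)
      (Γ.map Tm.wkC) (.eq x.wkC y.wkC T) :=
  .eq_of_bot (ent_left_right_bot (.hyp (.head _)))
    ((h.src.cutCons (.and isTope_left isTope_right) (.andLeft (.hyp (.head _)))).tope₁ isTope_bdry1)
    ((h.tgt.cutCons (.and isTope_left isTope_right) (.andRight (.hyp (.head _)))).tope₁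
      isTope_bdry1)

theorem ends_tm (h : ArrTy Ξ Φ Γ i T x y) :
    Der (.two :: Ξ) (bdry1 :: Φ.map Tope.wk) (Γ.map Tm.wkC) (.tm (.ends x y) T) :=
  .recOr (.hyp (by simp [bdry1])) (h.ty.of_top isTope_bdry1) (h.src.tope₁ isTope_bdry1)
    (h.tgt.tope₁ isTope_bdry1) h.ends_prem

theorem ends_left (h : ArrTy Ξ Φ Γ i T x y) :
    Der (.two :: Ξ) (.eq .zero (.var 0) :: Φ.map Tope.wk) (Γ.map Tm.wkC)
      (.eq (.ends x y) x.wkC T) :=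
  (Der.recOrLeft (.hyp (by simp [bdry1])) (h.ty.of_top isTope_bdry1) (h.src.tope₁ isTope_bdry1)
    (h.tgt.tope₁ isTope_bdry1) h.ends_prem).drop₁ (.orLeft (.hyp (by simp)) isTope_right)

theorem ends_right (h : ArrTy Ξ Φ Γ i T x y) :
    Der (.two :: Ξ) (.eq (.var 0) .one :: Φ.map Tope.wk) (Γ.map Tm.wkC)
      (.eq (.ends x y) y.wkC T) :=
  (Der.recOrRight (.hyp (by simp [bdry1])) (h.ty.of_top isTope_bdry1) (h.src.tope₁ isTope_bdry1)
    (h.tgt.tope₁ isTope_bdry1) h.ends_prem).drop₁ (.orRight (.hyp (by simp)) isTope_left)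

theorem form (h : ArrTy Ξ Φ Γ i T x y) : Der Ξ Φ Γ (.tm (.arr T x y) (.univ i)) :=
  .ext (.or (.eq .zero (.var rfl)) (.eq (.var rfl) .one)) .top .top h.wf h.ty h.ends_tm

/-- The boundary is a disjunction of topes, so equality over it may be tested at each end
separately. -/
theorem eq_ends (h : ArrTy Ξ Φ Γ i T x y) {b : Tm}
    (hb : Der (.two :: Ξ) (.top :: Φ.map Tope.wk) (Γ.map Tm.wkC) (.tm b T))
    (h₀ : Der (.two :: Ξ) (.eq .zero (.var 0) :: Φ.map Tope.wk) (Γ.map Tm.wkC) (.eq b x.wkC T))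
    (h₁ : Der (.two :: Ξ) (.eq (.var 0) .one :: Φ.map Tope.wk) (Γ.map Tm.wkC) (.eq b y.wkC T)) :
    Der (.two :: Ξ) (bdry1 :: Φ.map Tope.wk) (Γ.map Tm.wkC) (.eq b (.ends x y) T) :=
  .eq_of_or (.hyp (by simp [bdry1])) isTope_left isTope_right (h.ty.of_top isTope_bdry1)
    (hb.of_top isTope_bdry1) h.ends_tm
    ((h₀.eqTrans h.ends_left.eqSymm).tope₁ isTope_bdry1)
    ((h₁.eqTrans h.ends_right.eqSymm).tope₁ isTope_bdry1)

theorem lam (h : ArrTy Ξ Φ Γ i T x y) {b : Tm}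
    (hb : Der (.two :: Ξ) (.top :: Φ.map Tope.wk) (Γ.map Tm.wkC) (.tm b T))
    (h₀ : Der (.two :: Ξ) (.eq .zero (.var 0) :: Φ.map Tope.wk) (Γ.map Tm.wkC) (.eq b x.wkC T))
    (h₁ : Der (.two :: Ξ) (.eq (.var 0) .one :: Φ.map Tope.wk) (Γ.map Tm.wkC) (.eq b y.wkC T)) :
    Der Ξ Φ Γ (.tm (.extLam .two .top b) (.arr T x y)) :=
  .extLam h.form hb (h.eq_ends hb h₀ h₁)

theorem lam_congr (h : ArrTy Ξ Φ Γ i T x y) {b b' : Tm}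
    (hb : Der (.two :: Ξ) (.top :: Φ.map Tope.wk) (Γ.map Tm.wkC) (.tm b T))
    (hb' : Der (.two :: Ξ) (.top :: Φ.map Tope.wk) (Γ.map Tm.wkC) (.eq b b' T))
    (h₀ : Der (.two :: Ξ) (.eq .zero (.var 0) :: Φ.map Tope.wk) (Γ.map Tm.wkC) (.eq b x.wkC T))
    (h₁ : Der (.two :: Ξ) (.eq (.var 0) .one :: Φ.map Tope.wk) (Γ.map Tm.wkC) (.eq b y.wkC T)) :
    Der Ξ Φ Γ (.eq (.extLam .two .top b) (.extLam .two .top b') (.arr T x y)) :=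
  .extLamCong h.form hb' (h.eq_ends hb h₀ h₁)

theorem beta (h : ArrTy Ξ Φ Γ i T x y) {b : Tm} {s : CTm}
    (hb : Der (.two :: Ξ) (.top :: Φ.map Tope.wk) (Γ.map Tm.wkC) (.tm b T))
    (h₀ : Der (.two :: Ξ) (.eq .zero (.var 0) :: Φ.map Tope.wk) (Γ.map Tm.wkC) (.eq b x.wkC T))
    (h₁ : Der (.two :: Ξ) (.eq (.var 0) .one :: Φ.map Tope.wk) (Γ.map Tm.wkC) (.eq b y.wkC T))
    (hs : CTy Ξ s .two) :
    Der Ξ Φ Γ (.eq (.extApp (.extLam .two .top b) s) (b.instC s) (T.instC s)) :=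
  .extBeta h.form hb (h.eq_ends hb h₀ h₁) hs .top

end ArrTy

namespace Der

variable {Ξ : List Cube} {Φ : List Tope} {Γ : List Tm} {i : ℕ} {T x y f : Tm}

theorem _root_.STT.Tm.ren_upr_instC (a : Tm) :
    (a.ren (upr Nat.succ) _root_.id).instC (.var 0) = a := by
  rw [Tm.instC, Tm.ren_sub]
  exact Tm.sub_eq_self (by rintro (_ | k) <;> rfl) fun _ => rfl

/-- Evaluation at the generic point. Weakening the family below its own cube binder and then
substituting the new variable gives the family back. -/
theorem arr_app (h : Der Ξ Φ Γ (.tm f (.arr T x y))) {φ : Tope} (hφ : IsTope (.two :: Ξ) φ) :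
    Der (.two :: Ξ) (φ :: Φ.map Tope.wk) (Γ.map Tm.wkC) (.tm (.extApp f.wkC (.var 0)) T) := by
  have := Der.extApp (s := .var 0) (h.tm_wkC hφ) (.var rfl) .top
  rwa [Tm.ren_upr_instC] at this

theorem arr_app_ends (h : Der Ξ Φ Γ (.tm f (.arr T x y))) {φ : Tope} (hφ : IsTope (.two :: Ξ) φ)
    (hb : Ent (.two :: Ξ) (φ :: Φ.map Tope.wk) bdry1) :
    Der (.two :: Ξ) (φ :: Φ.map Tope.wk) (Γ.map Tm.wkC)
      (.eq (.extApp f.wkC (.var 0)) (.ends x y) T) := by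
  have := Der.extAppBoundary (s := .var 0) (h.tm_wkC hφ) (.var rfl) hb
  rwa [Tm.ren_upr_instC, Tm.ren_upr_instC] at this

theorem arr_app_left (h : Der Ξ Φ Γ (.tm f (.arr T x y))) (hT : ArrTy Ξ Φ Γ i T x y) :
    Der (.two :: Ξ) (.eq .zero (.var 0) :: Φ.map Tope.wk) (Γ.map Tm.wkC)
      (.eq (.extApp f.wkC (.var 0)) x.wkC T) :=
  (h.arr_app_ends isTope_left (.orLeft (.hyp (by simp)) isTope_right)).eqTrans hT.ends_left

theorem arr_app_right (h : Der Ξ Φ Γ (.tm f (.arr T x y))) (hT : ArrTy Ξ Φ Γ i T x y) :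
    Der (.two :: Ξ) (.eq (.var 0) .one :: Φ.map Tope.wk) (Γ.map Tm.wkC)
      (.eq (.extApp f.wkC (.var 0)) y.wkC T) :=
  (h.arr_app_ends isTope_right (.orRight (.hyp (by simp)) isTope_left)).eqTrans hT.ends_right

theorem arr_app_congr (h : Der Ξ Φ Γ (.tm f (.arr T x y))) {s t : CTm} (hs : CTy Ξ s .two)
    (ht : CTy Ξ t .two) (hst : Ent Ξ Φ (.eq s t)) :
    Der Ξ Φ Γ (.eq (.extApp f s) (.extApp f t) (T.instC s)) :=
  Der.extAppCong h.eqRefl hs ht hst .top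

variable {A : Tm}

/-- `hom A x y` unfolds to `arr A.wkC x y`, the case of a constant family, so the rules for `arr`
apply to it. -/
theorem homTy (hA : Der Ξ Φ Γ (.tm A (.univ i))) (hx : Der Ξ Φ Γ (.tm x A))
    (hy : Der Ξ Φ Γ (.tm y A)) : ArrTy Ξ Φ Γ i A.wkC x y :=
  ⟨hA.wf, hA.tm_wkC .top, hx.tm_wkC isTope_left, hy.tm_wkC isTope_right⟩

theorem hom (hA : Der Ξ Φ Γ (.tm A (.univ i))) (hx : Der Ξ Φ Γ (.tm x A))
    (hy : Der Ξ Φ Γ (.tm y A)) : Der Ξ Φ Γ (.tm (.hom A x y) (.univ i)) :=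
  (homTy hA hx hy).form

theorem hom_app (hf : Der Ξ Φ Γ (.tm f (.hom A x y))) {s : CTm} (hs : CTy Ξ s .two) :
    Der Ξ Φ Γ (.tm (.extApp f s) A) := by
  have := Der.extApp (s := s) hf hs .top
  simpa using this

theorem hom_app_zero (hA : Der Ξ Φ Γ (.tm A (.univ i))) (hx : Der Ξ Φ Γ (.tm x A))
    (hy : Der Ξ Φ Γ (.tm y A)) (hf : Der Ξ Φ Γ (.tm f (.hom A x y))) :
    Der Ξ Φ Γ (.eq (.extApp f .zero) x A) := by
  -- The equality over the tope `0 ≡ t` is instantiated at `t = 0`, where the tope holds by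
  -- reflexivity.
  have := (arr_app_left hf (homTy hA hx hy)).instC hA.wf .zero (.eqRefl .zero)
  simpa [Jdg.sub] using this

theorem hom_app_one (hA : Der Ξ Φ Γ (.tm A (.univ i))) (hx : Der Ξ Φ Γ (.tm x A))
    (hy : Der Ξ Φ Γ (.tm y A)) (hf : Der Ξ Φ Γ (.tm f (.hom A x y))) :
    Der Ξ Φ Γ (.eq (.extApp f .one) y A) := by
  have := (arr_app_right hf (homTy hA hx hy)).instC hA.wf .one (.eqRefl .one)
  simpa [Jdg.sub] using this

theorem idArr (hA : Der Ξ Φ Γ (.tm A (.univ i))) (hx : Der Ξ Φ Γ (.tm x A)) :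
    Der Ξ Φ Γ (.tm (.idArr x) (.hom A x x)) :=
  (homTy hA hx hx).lam (hx.tm_wkC .top) (hx.tm_wkC isTope_left).eqRefl
    (hx.tm_wkC isTope_right).eqRefl

end Der

/-! ### Paths, contractibility, function extensionality, equivalences -/

namespace Der

variable {Ξ : List Cube} {Φ : List Tope} {Γ : List Tm} {i j : ℕ} {A B X Y c x z w p f g h T : Tm}

theorem contr_center (hc : Der Ξ Φ Γ (.tm c (Tm.isContr T))) : Der Ξ Φ Γ (.tm (.fst c) T) :=
  hc.fst

theorem contr_path (hc : Der Ξ Φ Γ (.tm c (Tm.isContr T))) (hx : Der Ξ Φ Γ (.tm x T)) :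
    Der Ξ Φ Γ (.tm (.app (.snd c) x) (.id T (.fst c) x)) := by
  have := hc.snd
  -- Pushing the instantiation inward exposes the Π-type that the application rule needs.
  simp only [Tm.inst, Tm.tsub, Tm.sub] at this
  simpa using this.app (a := x) (by simpa using hx)

theorem app_arrow (hf : Der Ξ Φ Γ (.tm f (.arrow A B))) (hx : Der Ξ Φ Γ (.tm x A)) :
    Der Ξ Φ Γ (.tm (.app f x) B) := by
  simpa using hf.app hx

/-- Path induction with motive `fst z = fst y`, i.e. the action of the first projection on paths. It
turns contractibility of a type of lifts into an identification of end points. -/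
theorem fst_path (hX : Der Ξ Φ Γ (.tm X (.univ i))) (hXY : Der Ξ Φ Γ (.tm (.sigma X Y) (.univ j)))
    (hz : Der Ξ Φ Γ (.tm z (.sigma X Y))) (hw : Der Ξ Φ Γ (.tm w (.sigma X Y)))
    (hp : Der Ξ Φ Γ (.tm p (.id (.sigma X Y) z w))) :
    ∃ q, Der Ξ Φ Γ (.tm q (.id X (.fst z) (.fst w))) := by
  have hId : Der Ξ Φ (.sigma X Y :: Γ)
      (.tm (.id (Tm.sigma X Y).wk z.wk (.var 0)) (.univ j)) :=
    .id (hXY.tm_wk hXY) (hz.tm_wk hXY) hXY.var₀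
  have hv := hXY.var₀.fst.tm_wk hId
  have := Der.J (C := .id X.wk.wk (Tm.fst z).wk.wk (.fst (.var 1))) (c := .refl (.fst z)) hz
    (.id ((hX.tm_wk hXY).tm_wk hId) ((hz.fst.tm_wk hXY).tm_wk hId) hv)
    (by simpa using hz.fst.refl) hw hp
  exact ⟨_, by simpa using this⟩

theorem funext_path (hf : Der Ξ Φ Γ (.tm f (.pi A B))) (hg : Der Ξ Φ Γ (.tm g (.pi A B)))
    (hh : Der Ξ Φ Γ (.tm h (Tm.homotopy A B f g))) :
    ∃ p, Der Ξ Φ Γ (.tm p (.id (.pi A B) f g)) :=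
  -- The right inverse of `happly` is a function from homotopies to paths.
  ⟨_, app_arrow (hf.funext hg).fst.fst hh⟩

/-- Weakening by a variable below the last variable. -/
theorem wk_under {J : Jdg} (h : Der Ξ Φ (A :: Γ) J) (hB : Der Ξ Φ Γ (.tm B (.univ i))) :
    Der Ξ Φ (A.wk :: B :: Γ) (J.sub CTm.var (fun k => .var (upr (· + 1) k))) := by
  obtain ⟨-, k, hA⟩ := ctx_cons_iff.1 h.wf
  have hΓ : Der Ξ Φ (A.wk :: B :: Γ) .ctx := .ctxCons (.ctxCons hB.wf hB) (hA.tm_wk hB)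
  refine h.subst hΓ (fun k I hk => .var hk) (fun φ hφ => ?_) ?_
  · rw [Tope.sub_var]; exact .hyp hφ
  · rintro (_ | k) D hk
    · cases hk
      have := Der.var (k := 0) hΓ rfl
      simpa using this
    · have := Der.var (k := k + 2) (A := D) hΓ hk
      rw [Tm.wkN_eq_sub] at this ⊢
      rw [Tm.sub_sub]
      exact this

theorem _root_.STT.Tm.wk_under_inst (b : Tm) :
    (b.sub CTm.var (fun k => .var (upr (· + 1) k))).inst (.var 0) = b := by
  rw [Tm.inst, Tm.tsub, Tm.sub_sub]
  exact Tm.sub_eq_self (fun _ => rfl) (by rintro (_ | k) <;> rfl)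

/-- `β`-reduction of a weakened abstraction at the last variable. -/
theorem beta_wk {b : Tm} (hA : Der Ξ Φ Γ (.tm A (.univ i))) (hb : Der Ξ Φ (A :: Γ) (.tm b B)) :
    Der Ξ Φ (A :: Γ) (.eq (.app (Tm.lam A b).wk (.var 0)) b B) := by
  have := Der.piBeta (hb.wk_under hA) hA.var₀
  rw [Tm.wk_under_inst, Tm.wk_under_inst] at this
  convert this using 2
  rw [Tm.wk, Tm.wkN, Tm.ren, ← Tm.wkN, ← Tm.wk, Tm.ren_eq_sub b]
  rfl

/-- Homotopies concern the applications of the two abstractions to a variable, while `p` concerns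
the bodies; β converts one into the other. -/
theorem lam_path {b b' : Tm} (hA : Der Ξ Φ Γ (.tm A (.univ i)))
    (hB : Der Ξ Φ (A :: Γ) (.tm B (.univ j))) (hb : Der Ξ Φ (A :: Γ) (.tm b B))
    (hb' : Der Ξ Φ (A :: Γ) (.tm b' B)) (hp : Der Ξ Φ (A :: Γ) (.tm p (.id B b b'))) :
    ∃ q, Der Ξ Φ Γ (.tm q (.id (.pi A B) (.lam A b) (.lam A b'))) :=
  funext_path (hA.lam hb) (hA.lam hb') (h := .lam A p) <| hA.lam <|
    hp.conv (Der.idCong hB.eqRefl (beta_wk hA hb).eqSymm (beta_wk hA hb').eqSymm)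

theorem _root_.STT.Tm.arrow_sub (ρ : ℕ → CTm) (σ : ℕ → Tm) (A B : Tm) :
    (Tm.arrow A B).sub ρ σ = .arrow (A.sub ρ σ) (B.sub ρ σ) := by
  simp [Tm.arrow]

theorem _root_.STT.Tm.isContr_sub (ρ : ℕ → CTm) (σ : ℕ → Tm) (A : Tm) :
    (Tm.isContr A).sub ρ σ = .isContr (A.sub ρ σ) := by
  simp [Tm.isContr]

attribute [simp] Tm.arrow_sub Tm.isContr_sub

theorem arrow (hA : Der Ξ Φ Γ (.tm A (.univ i))) (hB : Der Ξ Φ Γ (.tm B (.univ i))) :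
    Der Ξ Φ Γ (.tm (.arrow A B) (.univ i)) :=
  .pi hA (hB.tm_wk hA)

/-- A function with a two-sided inverse up to homotopy is an equivalence. -/
theorem isEquiv {q : Tm} (hA : Der Ξ Φ Γ (.tm A (.univ i))) (hB : Der Ξ Φ Γ (.tm B (.univ i)))
    (hf : Der Ξ Φ Γ (.tm f (.arrow A B))) (hg : Der Ξ Φ Γ (.tm g (.arrow B A)))
    (hp : Der Ξ Φ (B :: Γ) (.tm p (.id B.wk (.app f.wk (.app g.wk (.var 0))) (.var 0))))
    (hq : Der Ξ Φ (A :: Γ) (.tm q (.id A.wk (.app g.wk (.app f.wk (.var 0))) (.var 0)))) :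
    ∃ e, Der Ξ Φ Γ (.tm e (Tm.isEquiv A B f)) := by
  have hBA := arrow hB hA
  have hv : Der Ξ Φ (.arrow B A :: Γ) (.tm (.var 0) (.arrow B.wk A.wk)) := by
    simpa using hBA.var₀
  have hf' : Der Ξ Φ (.arrow B A :: Γ) (.tm f.wk (.arrow A.wk B.wk)) := by
    simpa using hf.tm_wk hBA
  have hA' := hA.tm_wk hBA
  have hB' := hB.tm_wk hBA
  have h₁ : Der Ξ Φ (.arrow B A :: Γ) (.tm (.pi B.wk (.id (B.wkN 2)
      (.app (f.wkN 2) (.app (.var 1) (.var 0))) (.var 0))) (.univ i)) := by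
    refine .pi hB' ?_
    have k₁ := hv.tm_wk hB'
    have k₂ := hf'.tm_wk hB'
    have := Der.id (hB'.tm_wk hB') (app_arrow (A := A.wk.wk) (by simpa using k₂)
      (app_arrow (A := B.wk.wk) (by simpa using k₁) hB'.var₀)) hB'.var₀
    simpa using this
  have h₂ : Der Ξ Φ (.arrow B A :: Γ) (.tm (.pi A.wk (.id (A.wkN 2)
      (.app (.var 1) (.app (f.wkN 2) (.var 0))) (.var 0))) (.univ i)) := by
    refine .pi hA' ?_
    have k₁ := hv.tm_wk hA'
    have k₂ := hf'.tm_wk hA'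
    have := Der.id (hA'.tm_wk hA') (app_arrow (A := B.wk.wk) (by simpa using k₁)
      (app_arrow (A := A.wk.wk) (by simpa using k₂) hA'.var₀)) hA'.var₀
    simpa using this
  have s₁ := Der.pair h₁ hg (b := .lam B p) (by simpa using hB.lam hp)
  have s₂ := Der.pair h₂ hg (b := .lam A q) (by simpa using hA.lam hq)
  exact ⟨_, .pair ((Der.sigma hBA h₂).tm_wk (Der.sigma hBA h₁)) s₁ (by simpa using s₂)⟩

/-- All earlier variables are substituted by themselves, so `b ≡ b'` is the only equality that
`substCong` needs. -/
theorem congr_inst {b b' : Tm} (h : Der Ξ Φ (B :: Γ) (.tm c T))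
    (hb : Der Ξ Φ Γ (.eq b b' B)) :
    Der Ξ Φ Γ (.eq (c.inst b) (c.inst b') (T.inst b)) := by
  refine h.substCong hb.wf (fun k I hk => .var hk) (fun k I hk => .var hk)
    (fun k I hk => .eqRefl (.var hk)) (fun φ hφ => ?_) ?_
  · rw [Tope.sub_var]; exact .hyp hφ
  · rintro (_ | k) A hk
    · cases hk
      rw [Tm.wkN, Tm.ren_sub]
      exact (Tm.sub_var B).symm ▸ hb
    · rw [Tm.wkN, Tm.ren_sub]
      have := Der.var (k := k) (A := A) hb.wf hk
      rw [Tm.wkN, Tm.ren_eq_sub] at this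
      exact this.eqRefl

end Der

/-! ### The connection `f (min r s)` -/

/-- The arrow `λ r, f (min r s)` from `f 0` to `f s`. -/
def Tm.conn (f : Tm) (s : CTm) : Tm :=
  .extLam .two .top (.recOr (.le (.var 0) (s.ren Nat.succ)) (.le (s.ren Nat.succ) (.var 0))
    (.extApp f.wkC (.var 0)) (.extApp f.wkC (s.ren Nat.succ)))

theorem Tm.conn_sub (f : Tm) (s : CTm) (ρ : ℕ → CTm) (σ : ℕ → Tm) :
    (Tm.conn f s).sub ρ σ = .conn (f.sub ρ σ) (s.sub ρ) := by
  simp [Tm.conn]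

theorem CTy.wk {Ξ : List Cube} {s : CTm} {I J : Cube} (h : CTy Ξ s I) :
    CTy (J :: Ξ) (s.ren Nat.succ) I := by
  rw [CTm.ren_eq_sub]
  exact h.sub fun k J hk => .var hk

/-- Substitution along `s ≡ t` in the tope `s ≤ x`, starting from reflexivity `s ≤ s`. -/
theorem Ent.le_of_eq {Ξ : List Cube} {Φ : List Tope} {s t : CTm} (hs : CTy Ξ s .two)
    (ht : CTy Ξ t .two) (h : Ent Ξ Φ (.eq s t)) : Ent Ξ Φ (.le s t) := by
  have := Ent.eqSubst (ψ := .le (s.ren Nat.succ) (.var 0)) hs ht (.le hs.wk (.var rfl)) h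
  simp only [Tope.inst, Tope.sub, CTm.ren_sub, CTm.sub, scons_succ, scons_zero] at this
  rw [show s.sub (fun k => .var k) = s from CTm.sub_var s] at this
  exact this (.leRefl hs)

namespace Der

variable {Ξ : List Cube} {Φ : List Tope} {Γ : List Tm} {i j : ℕ} {A a x y f : Tm} {s : CTm}

theorem conn_prem (hf : Der Ξ Φ Γ (.tm f (.hom A a x))) (hs : CTy Ξ s .two) {φ : Tope}
    (hφ : IsTope (.two :: Ξ) φ) :
    Der (.two :: Ξ) (φ :: Φ.map Tope.wk) (Γ.map Tm.wkC) (.tm (.extApp f.wkC (.var 0)) A.wkC) ∧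
    Der (.two :: Ξ) (φ :: Φ.map Tope.wk) (Γ.map Tm.wkC)
      (.tm (.extApp f.wkC (s.ren Nat.succ)) A.wkC) := by
  have h := hf.tm_wkC hφ
  have e : (Tm.hom A a x).wkC = Tm.hom A.wkC a.wkC x.wkC := by simp
  rw [e] at h
  exact ⟨hom_app h (.var rfl), hom_app h hs.wk⟩

theorem conn_eq_prem (hf : Der Ξ Φ Γ (.tm f (.hom A a x))) {φ : Tope}
    {Φ' : List Tope} (hφ : IsTope (.two :: Ξ) φ) (hΦ' : ∀ φ ∈ Φ', IsTope (.two :: Ξ) φ)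
    (hΦ : ∀ ψ ∈ φ :: Φ.map Tope.wk, ψ ∈ Φ') {t t' : CTm}
    (ht : CTy (.two :: Ξ) t .two) (ht' : CTy (.two :: Ξ) t' .two)
    (h : Ent (.two :: Ξ) Φ' (.eq t t')) :
    Der (.two :: Ξ) Φ' (Γ.map Tm.wkC) (.eq (.extApp f.wkC t) (.extApp f.wkC t') A.wkC) := by
  have k := (hf.tm_wkC hφ).cut hΦ' fun ψ hψ => .hyp (hΦ ψ hψ)
  have e : (Tm.hom A a x).wkC = Tm.hom A.wkC a.wkC x.wkC := by simp
  rw [e] at k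
  simpa using arr_app_congr k ht ht' h

theorem isTope_le (hs : CTy Ξ s .two) : IsTope (.two :: Ξ) (.le (.var 0) (s.ren Nat.succ)) :=
  .le (.var rfl) hs.wk

theorem isTope_ge (hs : CTy Ξ s .two) : IsTope (.two :: Ξ) (.le (s.ren Nat.succ) (.var 0)) :=
  .le hs.wk (.var rfl)

/-- On the overlap antisymmetry gives `r ≡ s`, so the two branches `f r` and `f s` agree and can be
glued. -/
theorem conn_and (hf : Der Ξ Φ Γ (.tm f (.hom A a x))) (hs : CTy Ξ s .two) :
    Der (.two :: Ξ) (.and (.le (.var 0) (s.ren Nat.succ)) (.le (s.ren Nat.succ) (.var 0)) :: .top ::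
      Φ.map Tope.wk) (Γ.map Tm.wkC)
      (.eq (.extApp f.wkC (.var 0)) (.extApp f.wkC (s.ren Nat.succ)) A.wkC) := by
  refine conn_eq_prem hf .top ?_ (fun ψ hψ => List.mem_cons_of_mem _ hψ) (.var rfl) hs.wk
    (.leAntisymm (.andLeft (.hyp (.head _))) (.andRight (.hyp (.head _))))
  have := (hf.tm_wkC (I := .two) .top).ctx_topes
  exact List.forall_mem_cons.2 ⟨.and (isTope_le hs) (isTope_ge hs), this⟩

theorem conn_body (hA : Der Ξ Φ Γ (.tm A (.univ i))) (hf : Der Ξ Φ Γ (.tm f (.hom A a x)))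
    (hs : CTy Ξ s .two) :
    Der (.two :: Ξ) (.top :: Φ.map Tope.wk) (Γ.map Tm.wkC)
      (.tm (.recOr (.le (.var 0) (s.ren Nat.succ)) (.le (s.ren Nat.succ) (.var 0))
        (.extApp f.wkC (.var 0)) (.extApp f.wkC (s.ren Nat.succ))) A.wkC) :=
  .recOr (.leTotal (.var rfl) hs.wk) (hA.tm_wkC .top)
    ((conn_prem hf hs .top).1.tope (isTope_le hs)) ((conn_prem hf hs .top).2.tope (isTope_ge hs))
    (conn_and hf hs)

theorem conn_body_le (hA : Der Ξ Φ Γ (.tm A (.univ i))) (hf : Der Ξ Φ Γ (.tm f (.hom A a x)))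
    (hs : CTy Ξ s .two) :
    Der (.two :: Ξ) (.le (.var 0) (s.ren Nat.succ) :: .top :: Φ.map Tope.wk) (Γ.map Tm.wkC)
      (.eq (.recOr (.le (.var 0) (s.ren Nat.succ)) (.le (s.ren Nat.succ) (.var 0))
        (.extApp f.wkC (.var 0)) (.extApp f.wkC (s.ren Nat.succ))) (.extApp f.wkC (.var 0)) A.wkC) :=
  .recOrLeft (.leTotal (.var rfl) hs.wk) (hA.tm_wkC .top)
    ((conn_prem hf hs .top).1.tope (isTope_le hs)) ((conn_prem hf hs .top).2.tope (isTope_ge hs))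
    (conn_and hf hs)

theorem conn_body_ge (hA : Der Ξ Φ Γ (.tm A (.univ i))) (hf : Der Ξ Φ Γ (.tm f (.hom A a x)))
    (hs : CTy Ξ s .two) :
    Der (.two :: Ξ) (.le (s.ren Nat.succ) (.var 0) :: .top :: Φ.map Tope.wk) (Γ.map Tm.wkC)
      (.eq (.recOr (.le (.var 0) (s.ren Nat.succ)) (.le (s.ren Nat.succ) (.var 0))
        (.extApp f.wkC (.var 0)) (.extApp f.wkC (s.ren Nat.succ)))
        (.extApp f.wkC (s.ren Nat.succ)) A.wkC) :=
  .recOrRight (.leTotal (.var rfl) hs.wk) (hA.tm_wkC .top)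
    ((conn_prem hf hs .top).1.tope (isTope_le hs)) ((conn_prem hf hs .top).2.tope (isTope_ge hs))
    (conn_and hf hs)

/-- At `r ≡ 0` one has `r ≤ s`, so the value is `f r`, which is `f 0 ≡ a`. -/
theorem conn_left (hA : Der Ξ Φ Γ (.tm A (.univ i))) (ha : Der Ξ Φ Γ (.tm a A))
    (hx : Der Ξ Φ Γ (.tm x A)) (hf : Der Ξ Φ Γ (.tm f (.hom A a x))) (hs : CTy Ξ s .two) :
    Der (.two :: Ξ) (.eq .zero (.var 0) :: Φ.map Tope.wk) (Γ.map Tm.wkC)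
      (.eq (.recOr (.le (.var 0) (s.ren Nat.succ)) (.le (s.ren Nat.succ) (.var 0))
        (.extApp f.wkC (.var 0)) (.extApp f.wkC (s.ren Nat.succ))) a.wkC A.wkC) := by
  have h₁ := conn_body_le hA hf hs
  refine .eqTrans (h₁.cut ?_ ?_) (arr_app_left hf (homTy hA ha hx))
  · exact (hf.tm_wkC isTope_left).ctx_topes
  · have e : Ent (.two :: Ξ) (.eq .zero (.var 0) :: Φ.map Tope.wk) (.eq .zero (.var 0)) :=
      .hyp (.head _)
    refine List.forall_mem_cons.2 ⟨?_, List.forall_mem_cons.2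
      ⟨.top, fun _ h => .hyp (List.mem_cons_of_mem _ h)⟩⟩
    exact (Ent.le_of_eq (.var rfl) .zero e.eqSymm).leTrans (.zeroLe hs.wk)

/-- At `r ≡ 1` one has `s ≤ r`, so the value is `f s`. -/
theorem conn_right (hA : Der Ξ Φ Γ (.tm A (.univ i))) (hf : Der Ξ Φ Γ (.tm f (.hom A a x)))
    (hs : CTy Ξ s .two) :
    Der (.two :: Ξ) (.eq (.var 0) .one :: Φ.map Tope.wk) (Γ.map Tm.wkC)
      (.eq (.recOr (.le (.var 0) (s.ren Nat.succ)) (.le (s.ren Nat.succ) (.var 0))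
        (.extApp f.wkC (.var 0)) (.extApp f.wkC (s.ren Nat.succ))) (Tm.extApp f s).wkC A.wkC) := by
  refine (conn_body_ge hA hf hs).cut ?_ ?_
  · exact (hf.tm_wkC isTope_right).ctx_topes
  · have e : Ent (.two :: Ξ) (.eq (.var 0) .one :: Φ.map Tope.wk) (.eq (.var 0) .one) :=
      .hyp (.head _)
    refine List.forall_mem_cons.2 ⟨?_, List.forall_mem_cons.2
      ⟨.top, fun _ h => .hyp (List.mem_cons_of_mem _ h)⟩⟩
    exact (Ent.leOne hs.wk).leTrans (Ent.le_of_eq .one (.var rfl) e.eqSymm)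

theorem conn (hA : Der Ξ Φ Γ (.tm A (.univ i))) (ha : Der Ξ Φ Γ (.tm a A))
    (hx : Der Ξ Φ Γ (.tm x A)) (hf : Der Ξ Φ Γ (.tm f (.hom A a x))) (hs : CTy Ξ s .two) :
    Der Ξ Φ Γ (.tm (.conn f s) (.hom A a (.extApp f s))) :=
  (homTy hA ha (hom_app hf hs)).lam (conn_body hA hf hs) (conn_left hA ha hx hf hs)
    (conn_right hA hf hs)

/-- By uniqueness of glued elements, another body need only be compared with `f r` on `r ≤ s` and
with `f s` on `s ≤ r`. -/
theorem conn_eq {b : Tm} (hA : Der Ξ Φ Γ (.tm A (.univ i))) (ha : Der Ξ Φ Γ (.tm a A))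
    (hx : Der Ξ Φ Γ (.tm x A)) (hf : Der Ξ Φ Γ (.tm f (.hom A a x))) (hs : CTy Ξ s .two)
    (hb : Der (.two :: Ξ) (.top :: Φ.map Tope.wk) (Γ.map Tm.wkC) (.tm b A.wkC))
    (h₁ : Der (.two :: Ξ) (.le (.var 0) (s.ren Nat.succ) :: .top :: Φ.map Tope.wk) (Γ.map Tm.wkC)
      (.eq (.extApp f.wkC (.var 0)) b A.wkC))
    (h₂ : Der (.two :: Ξ) (.le (s.ren Nat.succ) (.var 0) :: .top :: Φ.map Tope.wk) (Γ.map Tm.wkC)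
      (.eq (.extApp f.wkC (s.ren Nat.succ)) b A.wkC)) :
    Der Ξ Φ Γ (.eq (.conn f s) (.extLam .two .top b) (.hom A a (.extApp f s))) :=
  (homTy hA ha (hom_app hf hs)).lam_congr (conn_body hA hf hs)
    (eq_of_or (.leTotal (.var rfl) hs.wk) (isTope_le hs) (isTope_ge hs) (hA.tm_wkC .top)
      (conn_body hA hf hs) hb ((conn_body_le hA hf hs).eqTrans h₁)
      ((conn_body_ge hA hf hs).eqTrans h₂))
    (conn_left hA ha hx hf hs) (conn_right hA hf hs)

theorem mem_wk {φ : Tope} (h : φ ∈ Φ) : φ.ren Nat.succ ∈ Φ.map Tope.wk :=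
  List.mem_map.2 ⟨φ, h, rfl⟩

/-- If `s ≡ 0`, then `r ≤ s` forces `r ≡ 0`, so both branches are `f 0 ≡ a`. The tope is assumed as
a member of `Φ` so that it survives weakening by `r`. -/
theorem conn_at_zero (hA : Der Ξ Φ Γ (.tm A (.univ i))) (ha : Der Ξ Φ Γ (.tm a A))
    (hx : Der Ξ Φ Γ (.tm x A)) (hf : Der Ξ Φ Γ (.tm f (.hom A a x))) (hs : CTy Ξ s .two)
    (h : .eq .zero s ∈ Φ) :
    Der Ξ Φ Γ (.eq (.conn f s) (.idArr a) (.hom A a (.extApp f s))) := by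
  have key : ∀ {φ : Tope}, IsTope (.two :: Ξ) φ → ∀ {t : CTm}, CTy (.two :: Ξ) t .two →
      Ent (.two :: Ξ) (φ :: .top :: Φ.map Tope.wk) (.eq t .zero) →
      Der (.two :: Ξ) (φ :: .top :: Φ.map Tope.wk) (Γ.map Tm.wkC)
        (.eq (.extApp f.wkC t) a.wkC A.wkC) := by
    intro φ hφ t ht e
    refine (conn_eq_prem hf .top (List.forall_mem_cons.2 ⟨hφ, (hf.tm_wkC .top).ctx_topes⟩)
      (fun ψ hψ => List.mem_cons_of_mem _ hψ) ht .zero e).eqTrans ?_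
    exact ((hom_app_zero hA ha hx hf).eq_wkC .top).tope hφ
  have h' : ∀ φ ψ : Tope, Ent (.two :: Ξ) (φ :: ψ :: Φ.map Tope.wk) (.eq .zero (s.ren Nat.succ)) :=
    fun φ ψ => .hyp (List.mem_cons_of_mem _ (List.mem_cons_of_mem _ (mem_wk h)))
  exact conn_eq hA ha hx hf hs (ha.tm_wkC .top)
    (key (isTope_le hs) (.var rfl) (.leAntisymm
      (.leTrans (.hyp (.head _)) (.le_of_eq hs.wk .zero (h' _ _).eqSymm)) (.zeroLe (.var rfl))))
    (key (isTope_ge hs) hs.wk (h' _ _).eqSymm)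

theorem hom_congr {y' : Tm} (hA : Der Ξ Φ Γ (.tm A (.univ i))) (hx : Der Ξ Φ Γ (.tm x A))
    (hy : Der Ξ Φ Γ (.eq y y' A)) :
    Der Ξ Φ Γ (.eq (.hom A x y) (.hom A x y') (.univ i)) := by
  simpa using congr_inst (hom (hA.tm_wk hA) (hx.tm_wk hA) hA.var₀) hy

/-- If `s ≡ 1`, then `s ≤ r` forces `r ≡ s`, so both branches are `f r`, and η recovers `f`. -/
theorem conn_at_one (hA : Der Ξ Φ Γ (.tm A (.univ i))) (ha : Der Ξ Φ Γ (.tm a A))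
    (hx : Der Ξ Φ Γ (.tm x A)) (hf : Der Ξ Φ Γ (.tm f (.hom A a x))) (hs : CTy Ξ s .two)
    (h : .eq s .one ∈ Φ) :
    Der Ξ Φ Γ (.eq (.conn f s) f (.hom A a (.extApp f s))) := by
  have h' : ∀ φ ψ : Tope, Ent (.two :: Ξ) (φ :: ψ :: Φ.map Tope.wk) (.eq (s.ren Nat.succ) .one) :=
    fun φ ψ => .hyp (List.mem_cons_of_mem _ (List.mem_cons_of_mem _ (mem_wk h)))
  have hb := (conn_prem hf hs .top).1
  refine (conn_eq hA ha hx hf hs hb (hb.tope (isTope_le hs)).eqRefl ?_).eqTrans ?_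
  · exact conn_eq_prem hf .top
      (List.forall_mem_cons.2 ⟨isTope_ge hs, (hf.tm_wkC .top).ctx_topes⟩)
      (fun ψ hψ => List.mem_cons_of_mem _ hψ) hs.wk (.var rfl)
      ((h' _ _).eqTrans (.leAntisymm (.leTrans (.le_of_eq .one hs.wk (h' _ _).eqSymm)
        (.hyp (.head _))) (.leOne (.var rfl))))
  -- The η-rule is an equality in `hom A a x`; the end point is moved along `x ≡ f 1 ≡ f s`.
  · refine hf.extEta.eqSymm.convEq (hom_congr hA ha ?_)
    refine (hom_app_one hA ha hx hf).eqSymm.eqTrans ?_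
    simpa using arr_app_congr hf .one hs (Ent.hyp h).eqSymm

theorem idArr_app (hA : Der Ξ Φ Γ (.tm A (.univ i))) (ha : Der Ξ Φ Γ (.tm a A))
    (hs : CTy Ξ s .two) : Der Ξ Φ Γ (.eq (.extApp (.idArr a) s) a A) := by
  have := (homTy hA ha ha).beta (ha.tm_wkC .top) (ha.tm_wkC isTope_left).eqRefl
    (ha.tm_wkC isTope_right).eqRefl hs
  simpa [Tm.idArr] using this

theorem conn_idArr (hA : Der Ξ Φ Γ (.tm A (.univ i))) (ha : Der Ξ Φ Γ (.tm a A))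
    (hs : CTy Ξ s .two) :
    Der Ξ Φ Γ (.eq (.conn (.idArr a) s) (.idArr a) (.hom A a (.extApp (.idArr a) s))) := by
  have key : ∀ {φ : Tope}, IsTope (.two :: Ξ) φ → ∀ {t : CTm}, CTy (.two :: Ξ) t .two →
      Der (.two :: Ξ) (φ :: .top :: Φ.map Tope.wk) (Γ.map Tm.wkC)
        (.eq (.extApp (Tm.idArr a).wkC t) a.wkC A.wkC) := by
    intro φ hφ t ht
    have := (idArr_app (hA.tm_wkC (I := .two) .top) (ha.tm_wkC .top) ht).tope hφ
    simpa using this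
  exact conn_eq hA ha ha (idArr hA ha) hs (ha.tm_wkC .top) (key (isTope_le hs) (.var rfl))
    (key (isTope_ge hs) hs.wk)

end Der

/-! ### The coslice and its cone arrows -/

namespace Tm

theorem dhom_sub (ρ : ℕ → CTm) (σ : ℕ → Tm) (C f u v : Tm) :
    (dhom C f u v).sub ρ σ = dhom (C.sub ρ σ) (f.sub ρ σ) (u.sub ρ σ) (v.sub ρ σ) := by
  simp [dhom, ends, bdry1]

/-- The arrow `λ t, (f t, λ r, f (min r t))` from `(a, id_a)` to `(x, f)` in the coslice. -/
def coneArr (f : Tm) : Tm :=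
  .extLam .two .top (.pair (.extApp f.wkC (.var 0)) (.conn f.wkC (.var 0)))

theorem coneArr_sub (ρ : ℕ → CTm) (σ : ℕ → Tm) (f : Tm) :
    (coneArr f).sub ρ σ = coneArr (f.sub ρ σ) := by
  simp [coneArr, conn]

/-- The element of the contractible type of lifts of `coneArr f` that start at `u`. -/
def coneLift (a cov x f u : Tm) : Tm :=
  .fst (.app (.app (.app (.app cov (.pair a (.idArr a))) (.pair x f)) (coneArr f)) u)

theorem coneLift_sub (ρ : ℕ → CTm) (σ : ℕ → Tm) (a cov x f u : Tm) :
    (coneLift a cov x f u).sub ρ σ =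
      coneLift (a.sub ρ σ) (cov.sub ρ σ) (x.sub ρ σ) (f.sub ρ σ) (u.sub ρ σ) := by
  simp [coneLift, coneArr_sub]

theorem uncurry_sub (ρ : ℕ → CTm) (σ : ℕ → Tm) (A a C : Tm) :
    (uncurry A a C).sub ρ σ = uncurry (A.sub ρ σ) (a.sub ρ σ) (C.sub ρ σ) := by
  simp [uncurry]

theorem isCovariant_sub (ρ : ℕ → CTm) (σ : ℕ → Tm) (B D : Tm) :
    (isCovariant B D).sub ρ σ = isCovariant (B.sub ρ σ) (D.sub ρ σ) := by
  simp [isCovariant, dhom_sub]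

theorem famType_sub (ρ : ℕ → CTm) (σ : ℕ → Tm) (A a : Tm) (j : ℕ) :
    (famType A a j).sub ρ σ = famType (A.sub ρ σ) (a.sub ρ σ) j := by
  simp [famType]

theorem sections_sub (ρ : ℕ → CTm) (σ : ℕ → Tm) (A a C : Tm) :
    (sections A a C).sub ρ σ = sections (A.sub ρ σ) (a.sub ρ σ) (C.sub ρ σ) := by
  simp [sections]

theorem evid_sub (ρ : ℕ → CTm) (σ : ℕ → Tm) (A a C : Tm) :
    (evid A a C).sub ρ σ = evid (A.sub ρ σ) (a.sub ρ σ) (C.sub ρ σ) := by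
  simp [evid, sections_sub]

attribute [simp] dhom_sub coneArr_sub coneLift_sub uncurry_sub isCovariant_sub famType_sub
  sections_sub evid_sub

end Tm

namespace Der

variable {Ξ : List Cube} {Φ : List Tope} {Γ : List Tm} {i j : ℕ}
  {A a x y f B D C u v p q cov : Tm} {s : CTm}

theorem covariant_app (hcov : Der Ξ Φ Γ (.tm cov (.isCovariant B D)))
    (hx : Der Ξ Φ Γ (.tm x B)) (hy : Der Ξ Φ Γ (.tm y B)) (hf : Der Ξ Φ Γ (.tm f (.hom B x y)))
    (hu : Der Ξ Φ Γ (.tm u (.app D x))) :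
    Der Ξ Φ Γ (.tm (.app (.app (.app (.app cov x) y) f) u)
      (.isContr (.sigma (.app D y) (.dhom D.wk f.wk u.wk (.var 0))))) := by
  have h₁ := hcov.app hx
  simp only [Tm.inst, Tm.tsub, Tm.sub] at h₁
  have h₂ := h₁.app (a := y) (by simpa using hy)
  simp only [Tm.inst, Tm.tsub, Tm.sub] at h₂
  have h₃ := h₂.app (a := f) (by simpa using hf)
  simp only [Tm.inst, Tm.tsub, Tm.sub] at h₃
  have h₄ := h₃.app (a := u) (by simpa using hu)
  simpa using h₄

/-- `dhom D f u v` is an `arr` over the family `t ↦ D (f t)`. The elements `u : D x` and `v : D y`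
fit at the ends because `f t` is judgmentally `x` and `y` there. -/
theorem dhomTy (hB : Der Ξ Φ Γ (.tm B (.univ i))) (hD : Der Ξ Φ Γ (.tm D (.arrow B (.univ j))))
    (hx : Der Ξ Φ Γ (.tm x B)) (hy : Der Ξ Φ Γ (.tm y B)) (hf : Der Ξ Φ Γ (.tm f (.hom B x y)))
    (hu : Der Ξ Φ Γ (.tm u (.app D x))) (hv : Der Ξ Φ Γ (.tm v (.app D y))) :
    ArrTy Ξ Φ Γ j (.app D.wkC (.extApp f.wkC (.var 0))) u v := by
  have key : ∀ {φ : Tope}, IsTope (.two :: Ξ) φ →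
      Der (.two :: Ξ) (φ :: Φ.map Tope.wk) (Γ.map Tm.wkC) (.tm D.wkC (.pi B.wkC (.univ j))) :=
    fun hφ => by simpa [Tm.arrow] using hD.tm_wkC hφ
  refine ⟨hB.wf, (key .top).app (arr_app hf .top), ?_, ?_⟩
  · exact (hu.tm_wkC isTope_left).conv ((key isTope_left).eqRefl.appCong
      (arr_app_left hf (homTy hB hx hy)).eqSymm)
  · exact (hv.tm_wkC isTope_right).conv ((key isTope_right).eqRefl.appCong
      (arr_app_right hf (homTy hB hx hy)).eqSymm)

theorem coslice_fam (hA : Der Ξ Φ Γ (.tm A (.univ i))) (ha : Der Ξ Φ Γ (.tm a A)) :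
    Der Ξ Φ (A :: Γ) (.tm (.hom A.wk a.wk (.var 0)) (.univ i)) :=
  hom (hA.tm_wk hA) (ha.tm_wk hA) hA.var₀

theorem coslice (hA : Der Ξ Φ Γ (.tm A (.univ i))) (ha : Der Ξ Φ Γ (.tm a A)) :
    Der Ξ Φ Γ (.tm (.coslice A a) (.univ i)) :=
  .sigma hA (coslice_fam hA ha)

theorem coslice_pair (hA : Der Ξ Φ Γ (.tm A (.univ i))) (ha : Der Ξ Φ Γ (.tm a A))
    (hx : Der Ξ Φ Γ (.tm x A)) (hf : Der Ξ Φ Γ (.tm f (.hom A a x))) :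
    Der Ξ Φ Γ (.tm (.pair x f) (.coslice A a)) :=
  .pair (coslice_fam hA ha) hx (by simpa using hf)

theorem coslice_pair_congr {x' f' : Tm} (hA : Der Ξ Φ Γ (.tm A (.univ i)))
    (ha : Der Ξ Φ Γ (.tm a A)) (hx : Der Ξ Φ Γ (.eq x x' A))
    (hf : Der Ξ Φ Γ (.eq f f' (.hom A a x))) :
    Der Ξ Φ Γ (.eq (.pair x f) (.pair x' f') (.coslice A a)) :=
  .pairCong (coslice_fam hA ha) hx (by simpa using hf)

theorem coslice_snd (hp : Der Ξ Φ Γ (.tm p (.coslice A a))) :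
    Der Ξ Φ Γ (.tm (.snd p) (.hom A a (.fst p))) := by
  simpa using hp.snd

theorem coslice_fst_beta (hA : Der Ξ Φ Γ (.tm A (.univ i))) (ha : Der Ξ Φ Γ (.tm a A))
    (hx : Der Ξ Φ Γ (.tm x A)) (hf : Der Ξ Φ Γ (.tm f (.hom A a x))) :
    Der Ξ Φ Γ (.eq (.fst (.pair x f)) x A) :=
  .fstBeta (coslice_fam hA ha) hx (by simpa using hf)

theorem coslice_snd_beta (hA : Der Ξ Φ Γ (.tm A (.univ i))) (ha : Der Ξ Φ Γ (.tm a A))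
    (hx : Der Ξ Φ Γ (.tm x A)) (hf : Der Ξ Φ Γ (.tm f (.hom A a x))) :
    Der Ξ Φ Γ (.eq (.snd (.pair x f)) f (.hom A a x)) := by
  simpa using Der.sndBeta (coslice_fam hA ha) hx (b := f) (by simpa using hf)

theorem coneArr_body (hA : Der Ξ Φ Γ (.tm A (.univ i))) (ha : Der Ξ Φ Γ (.tm a A))
    (hx : Der Ξ Φ Γ (.tm x A)) (hf : Der Ξ Φ Γ (.tm f (.hom A a x))) {φ : Tope}
    (hφ : IsTope (.two :: Ξ) φ) :
    Der (.two :: Ξ) (φ :: Φ.map Tope.wk) (Γ.map Tm.wkC)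
      (.tm (.pair (.extApp f.wkC (.var 0)) (.conn f.wkC (.var 0))) (Tm.coslice A a).wkC) := by
  have hf' : Der (.two :: Ξ) (φ :: Φ.map Tope.wk) (Γ.map Tm.wkC)
      (.tm f.wkC (.hom A.wkC a.wkC x.wkC)) := by simpa using hf.tm_wkC hφ
  have e : (Tm.coslice A a).wkC = .coslice A.wkC a.wkC := by simp
  rw [e]
  exact coslice_pair (hA.tm_wkC hφ) (ha.tm_wkC hφ) (hom_app hf' (.var rfl))
    (conn (hA.tm_wkC hφ) (ha.tm_wkC hφ) (hx.tm_wkC hφ) hf' (.var rfl))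

/-- Over `0 ≡ t` both components reduce judgmentally: `f t` to `a` and the connection at `t` to
`id_a`. The cone parameter `t` plays the role of `s` in `conn_at_zero`. -/
theorem coneArr_left (hA : Der Ξ Φ Γ (.tm A (.univ i))) (ha : Der Ξ Φ Γ (.tm a A))
    (hx : Der Ξ Φ Γ (.tm x A)) (hf : Der Ξ Φ Γ (.tm f (.hom A a x))) :
    Der (.two :: Ξ) (.eq .zero (.var 0) :: Φ.map Tope.wk) (Γ.map Tm.wkC)
      (.eq (.pair (.extApp f.wkC (.var 0)) (.conn f.wkC (.var 0)))
        (Tm.pair a (.idArr a)).wkC (Tm.coslice A a).wkC) := by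
  have hφ := isTope_left (Ξ := Ξ)
  have hf' : Der (.two :: Ξ) (.eq .zero (.var 0) :: Φ.map Tope.wk) (Γ.map Tm.wkC)
      (.tm f.wkC (.hom A.wkC a.wkC x.wkC)) := by simpa using hf.tm_wkC hφ
  have := coslice_pair_congr (hA.tm_wkC hφ) (ha.tm_wkC hφ)
    (arr_app_left hf (homTy hA ha hx))
    (conn_at_zero (hA.tm_wkC hφ) (ha.tm_wkC hφ) (hx.tm_wkC hφ) hf' (.var rfl) (.head _))
  simpa using this

theorem coneArr_right (hA : Der Ξ Φ Γ (.tm A (.univ i))) (ha : Der Ξ Φ Γ (.tm a A))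
    (hx : Der Ξ Φ Γ (.tm x A)) (hf : Der Ξ Φ Γ (.tm f (.hom A a x))) :
    Der (.two :: Ξ) (.eq (.var 0) .one :: Φ.map Tope.wk) (Γ.map Tm.wkC)
      (.eq (.pair (.extApp f.wkC (.var 0)) (.conn f.wkC (.var 0)))
        (Tm.pair x f).wkC (Tm.coslice A a).wkC) := by
  have hφ := isTope_right (Ξ := Ξ)
  have hf' : Der (.two :: Ξ) (.eq (.var 0) .one :: Φ.map Tope.wk) (Γ.map Tm.wkC)
      (.tm f.wkC (.hom A.wkC a.wkC x.wkC)) := by simpa using hf.tm_wkC hφ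
  have := coslice_pair_congr (hA.tm_wkC hφ) (ha.tm_wkC hφ)
    (arr_app_right hf (homTy hA ha hx))
    (conn_at_one (hA.tm_wkC hφ) (ha.tm_wkC hφ) (hx.tm_wkC hφ) hf' (.var rfl) (.head _))
  simpa using this

theorem coslice_base (hA : Der Ξ Φ Γ (.tm A (.univ i))) (ha : Der Ξ Φ Γ (.tm a A)) :
    Der Ξ Φ Γ (.tm (.pair a (.idArr a)) (.coslice A a)) :=
  coslice_pair hA ha ha (idArr hA ha)

/-- The strict form of initiality of `(a, id_a)`: its end points hold judgmentally, so covariance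
applies to this arrow without any transport. -/
theorem coneArr (hA : Der Ξ Φ Γ (.tm A (.univ i))) (ha : Der Ξ Φ Γ (.tm a A))
    (hx : Der Ξ Φ Γ (.tm x A)) (hf : Der Ξ Φ Γ (.tm f (.hom A a x))) :
    Der Ξ Φ Γ (.tm (.coneArr f) (.hom (.coslice A a) (.pair a (.idArr a)) (.pair x f))) :=
  (homTy (coslice hA ha) (coslice_base hA ha) (coslice_pair hA ha hx hf)).lam
    (coneArr_body hA ha hx hf .top) (coneArr_left hA ha hx hf) (coneArr_right hA ha hx hf)

theorem fam_app₁ (hC : Der Ξ Φ Γ (.tm C (.famType A a j))) (hx : Der Ξ Φ Γ (.tm x A)) :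
    Der Ξ Φ Γ (.tm (.app C x) (.pi (.hom A a x) (.univ j))) := by
  have := hC.app hx
  simp only [Tm.inst, Tm.tsub, Tm.sub] at this
  simpa using this

theorem fam_app (hC : Der Ξ Φ Γ (.tm C (.famType A a j))) (hx : Der Ξ Φ Γ (.tm x A))
    (hf : Der Ξ Φ Γ (.tm f (.hom A a x))) :
    Der Ξ Φ Γ (.tm (.app (.app C x) f) (.univ j)) :=
  (fam_app₁ hC hx).app hf

theorem fam_app_congr {x' f' : Tm} (hC : Der Ξ Φ Γ (.tm C (.famType A a j)))
    (hx : Der Ξ Φ Γ (.eq x x' A))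
    (hf : Der Ξ Φ Γ (.eq f f' (.hom A a x))) :
    Der Ξ Φ Γ (.eq (.app (.app C x) f) (.app (.app C x') f') (.univ j)) := by
  have h := hC.eqRefl.appCong hx
  simp only [Tm.inst, Tm.tsub, Tm.sub] at h
  have h' : Der Ξ Φ Γ (.eq (.app C x) (.app C x') (.pi (.hom A a x) (.univ j))) := by
    simpa using h
  exact h'.appCong hf

theorem sections_app₁ {φ : Tm} (hφ : Der Ξ Φ Γ (.tm φ (.sections A a C)))
    (hx : Der Ξ Φ Γ (.tm x A)) :
    Der Ξ Φ Γ (.tm (.app φ x) (.pi (.hom A a x) (.app (.app C.wk x.wk) (.var 0)))) := by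
  have := hφ.app hx
  simp only [Tm.inst, Tm.tsub, Tm.sub] at this
  simpa using this

theorem sections_app {φ : Tm} (hφ : Der Ξ Φ Γ (.tm φ (.sections A a C)))
    (hx : Der Ξ Φ Γ (.tm x A)) (hf : Der Ξ Φ Γ (.tm f (.hom A a x))) :
    Der Ξ Φ Γ (.tm (.app (.app φ x) f) (.app (.app C x) f)) := by
  simpa using (sections_app₁ hφ hx).app hf

theorem sections_app_congr {φ φ' x' f' : Tm} (hφ : Der Ξ Φ Γ (.eq φ φ' (.sections A a C)))
    (hx : Der Ξ Φ Γ (.eq x x' A)) (hf : Der Ξ Φ Γ (.eq f f' (.hom A a x))) :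
    Der Ξ Φ Γ (.eq (.app (.app φ x) f) (.app (.app φ' x') f') (.app (.app C x) f)) := by
  have h := hφ.appCong hx
  simp only [Tm.inst, Tm.tsub, Tm.sub] at h
  have h' : Der Ξ Φ Γ (.eq (.app φ x) (.app φ' x')
    (.pi (.hom A a x) (.app (.app C.wk x.wk) (.var 0)))) := by simpa using h
  simpa using h'.appCong hf

theorem uncurry_body (hA : Der Ξ Φ Γ (.tm A (.univ i))) (ha : Der Ξ Φ Γ (.tm a A))
    (hC : Der Ξ Φ Γ (.tm C (.famType A a j))) :
    Der Ξ Φ (.coslice A a :: Γ)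
      (.tm (.app (.app C.wk (.fst (.var 0))) (.snd (.var 0))) (.univ j)) := by
  have hQ := coslice hA ha
  have hv : Der Ξ Φ (.coslice A a :: Γ) (.tm (.var 0) (.coslice A.wk a.wk)) := by
    simpa using hQ.var₀
  exact fam_app (A := A.wk) (a := a.wk) (by simpa using hC.tm_wk hQ) hv.fst (coslice_snd hv)

theorem uncurry (hA : Der Ξ Φ Γ (.tm A (.univ i))) (ha : Der Ξ Φ Γ (.tm a A))
    (hC : Der Ξ Φ Γ (.tm C (.famType A a j))) :
    Der Ξ Φ Γ (.tm (.uncurry A a C) (.arrow (.coslice A a) (.univ j))) :=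
  (coslice hA ha).lam (uncurry_body hA ha hC)

theorem uncurry_app (hA : Der Ξ Φ Γ (.tm A (.univ i))) (ha : Der Ξ Φ Γ (.tm a A))
    (hC : Der Ξ Φ Γ (.tm C (.famType A a j))) (hp : Der Ξ Φ Γ (.tm p (.coslice A a))) :
    Der Ξ Φ Γ (.eq (.app (.uncurry A a C) p) (.app (.app C (.fst p)) (.snd p)) (.univ j)) := by
  simpa [Tm.uncurry] using (uncurry_body hA ha hC).piBeta hp

theorem uncurry_pair (hA : Der Ξ Φ Γ (.tm A (.univ i))) (ha : Der Ξ Φ Γ (.tm a A))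
    (hC : Der Ξ Φ Γ (.tm C (.famType A a j))) (hx : Der Ξ Φ Γ (.tm x A))
    (hf : Der Ξ Φ Γ (.tm f (.hom A a x))) :
    Der Ξ Φ Γ (.eq (.app (.uncurry A a C) (.pair x f)) (.app (.app C x) f) (.univ j)) :=
  have hp := coslice_pair hA ha hx hf
  have e := coslice_fst_beta hA ha hx hf
  (uncurry_app hA ha hC hp).eqTrans <| fam_app_congr hC e <|
    -- The second projections must be compared over the end point `fst (pair x f)`, not over `x`.
    (coslice_snd_beta hA ha hx hf).convEq (hom_congr hA ha e.eqSymm)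

end Der

/-! ### Lifts of cone arrows -/

namespace Der

variable {Ξ : List Cube} {Φ : List Tope} {Γ : List Tm} {i j : ℕ}
  {A a x f C u v k cov φ : Tm} {s : CTm}

theorem coneArr_app (hA : Der Ξ Φ Γ (.tm A (.univ i))) (ha : Der Ξ Φ Γ (.tm a A))
    (hx : Der Ξ Φ Γ (.tm x A)) (hf : Der Ξ Φ Γ (.tm f (.hom A a x))) (hs : CTy Ξ s .two) :
    Der Ξ Φ Γ (.eq (.extApp (.coneArr f) s) (.pair (.extApp f s) (.conn f s)) (.coslice A a)) := by
  have := (homTy (coslice hA ha) (coslice_base hA ha) (coslice_pair hA ha hx hf)).beta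
    (coneArr_body hA ha hx hf .top) (coneArr_left hA ha hx hf) (coneArr_right hA ha hx hf) hs
  simpa [Tm.coneArr, Tm.conn_sub] using this

/-- The identity arrow is constant and so is its connection; hence its cone arrow is constant at
`(a, id_a)`. -/
theorem coneArr_idArr_app (hA : Der Ξ Φ Γ (.tm A (.univ i))) (ha : Der Ξ Φ Γ (.tm a A))
    (hs : CTy Ξ s .two) :
    Der Ξ Φ Γ (.eq (.extApp (.coneArr (.idArr a)) s) (.pair a (.idArr a)) (.coslice A a)) :=
  (coneArr_app hA ha ha (idArr hA ha) hs).eqTrans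
    (coslice_pair_congr hA ha (idArr_app hA ha hs) (conn_idArr hA ha hs))

theorem fiberAtId (hA : Der Ξ Φ Γ (.tm A (.univ i))) (ha : Der Ξ Φ Γ (.tm a A))
    (hC : Der Ξ Φ Γ (.tm C (.famType A a j))) : Der Ξ Φ Γ (.tm (.fiberAtId a C) (.univ j)) :=
  fam_app hC ha (idArr hA ha)

/-- Covariance concerns the uncurried family and sections the curried one; this conversion passes
between them. -/
theorem to_uncurry (hA : Der Ξ Φ Γ (.tm A (.univ i))) (ha : Der Ξ Φ Γ (.tm a A))
    (hC : Der Ξ Φ Γ (.tm C (.famType A a j))) (hx : Der Ξ Φ Γ (.tm x A))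
    (hf : Der Ξ Φ Γ (.tm f (.hom A a x))) (hu : Der Ξ Φ Γ (.tm u (.app (.app C x) f))) :
    Der Ξ Φ Γ (.tm u (.app (.uncurry A a C) (.pair x f))) :=
  hu.conv (uncurry_pair hA ha hC hx hf).eqSymm

theorem coneLift_contr (hA : Der Ξ Φ Γ (.tm A (.univ i))) (ha : Der Ξ Φ Γ (.tm a A))
    (hC : Der Ξ Φ Γ (.tm C (.famType A a j)))
    (hcov : Der Ξ Φ Γ (.tm cov (.isCovariant (.coslice A a) (.uncurry A a C))))
    (hx : Der Ξ Φ Γ (.tm x A)) (hf : Der Ξ Φ Γ (.tm f (.hom A a x)))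
    (hu : Der Ξ Φ Γ (.tm u (.fiberAtId a C))) :
    Der Ξ Φ Γ (.tm (.app (.app (.app (.app cov (.pair a (.idArr a))) (.pair x f)) (.coneArr f)) u)
      (.isContr (.sigma (.app (.uncurry A a C) (.pair x f))
        (.dhom (Tm.uncurry A a C).wk (Tm.coneArr f).wk u.wk (.var 0))))) :=
  covariant_app hcov (coslice_base hA ha) (coslice_pair hA ha hx hf) (coneArr hA ha hx hf)
    (to_uncurry hA ha hC ha (idArr hA ha) hu)

theorem coneLift_fst (hA : Der Ξ Φ Γ (.tm A (.univ i))) (ha : Der Ξ Φ Γ (.tm a A))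
    (hC : Der Ξ Φ Γ (.tm C (.famType A a j)))
    (hcov : Der Ξ Φ Γ (.tm cov (.isCovariant (.coslice A a) (.uncurry A a C))))
    (hx : Der Ξ Φ Γ (.tm x A)) (hf : Der Ξ Φ Γ (.tm f (.hom A a x)))
    (hu : Der Ξ Φ Γ (.tm u (.fiberAtId a C))) :
    Der Ξ Φ Γ (.tm (.fst (.coneLift a cov x f u)) (.app (.app C x) f)) :=
  (coneLift_contr hA ha hC hcov hx hf hu).contr_center.fst.conv (uncurry_pair hA ha hC hx hf)

theorem dhom_fam (hA : Der Ξ Φ Γ (.tm A (.univ i))) (ha : Der Ξ Φ Γ (.tm a A))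
    (hC : Der Ξ Φ Γ (.tm C (.famType A a j)))
    (hx : Der Ξ Φ Γ (.tm x A)) (hf : Der Ξ Φ Γ (.tm f (.hom A a x)))
    (hu : Der Ξ Φ Γ (.tm u (.fiberAtId a C))) :
    Der Ξ Φ (.app (.uncurry A a C) (.pair x f) :: Γ)
      (.tm (.dhom (Tm.uncurry A a C).wk (Tm.coneArr f).wk u.wk (.var 0)) (.univ j)) := by
  have hq := coslice_pair hA ha hx hf
  have hD := app_arrow (uncurry hA ha hC) hq
  have hu' := to_uncurry hA ha hC ha (idArr hA ha) hu
  exact (dhomTy ((coslice hA ha).tm_wk hD) (by simpa using (uncurry hA ha hC).tm_wk hD)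
    ((coslice_base hA ha).tm_wk hD) (hq.tm_wk hD) (by simpa using (coneArr hA ha hx hf).tm_wk hD)
    (by simpa using hu'.tm_wk hD) (by simpa using hD.var₀)).form

/-- The end point of the chosen lift is identified with the end point of any other lift. -/
theorem coneLift_path (hA : Der Ξ Φ Γ (.tm A (.univ i))) (ha : Der Ξ Φ Γ (.tm a A))
    (hC : Der Ξ Φ Γ (.tm C (.famType A a j)))
    (hcov : Der Ξ Φ Γ (.tm cov (.isCovariant (.coslice A a) (.uncurry A a C))))
    (hx : Der Ξ Φ Γ (.tm x A)) (hf : Der Ξ Φ Γ (.tm f (.hom A a x)))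
    (hu : Der Ξ Φ Γ (.tm u (.fiberAtId a C))) (hv : Der Ξ Φ Γ (.tm v (.app (.app C x) f)))
    (hk : Der Ξ Φ Γ (.tm k (.dhom (.uncurry A a C) (.coneArr f) u v))) :
    ∃ p, Der Ξ Φ Γ (.tm p (.id (.app (.app C x) f) (.fst (.coneLift a cov x f u)) v)) := by
  have hc := coneLift_contr hA ha hC hcov hx hf hu
  have hF := dhom_fam hA ha hC hx hf hu
  have hD := app_arrow (uncurry hA ha hC) (coslice_pair hA ha hx hf)
  have hv' := to_uncurry hA ha hC hx hf hv
  have hk' : Der Ξ Φ Γ (.tm k ((Tm.dhom (Tm.uncurry A a C).wk (Tm.coneArr f).wk u.wk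
    (.var 0)).inst v)) := by simpa using hk
  have hw := Der.pair hF hv' hk'
  -- Contractibility joins the chosen lift to the pair `(v, k)`; the first projection of that path
  -- identifies the end points.
  obtain ⟨p, hp⟩ := fst_path hD (.sigma hD hF) hc.contr_center hw (hc.contr_path hw)
  exact ⟨p, hp.conv (.idCong (uncurry_pair hA ha hC hx hf) hc.contr_center.fst.eqRefl
    (.fstBeta hF hv' hk'))⟩

theorem fam_wkC (hC : Der Ξ Φ Γ (.tm C (.famType A a j))) {ψ : Tope}
    (hψ : IsTope (.two :: Ξ) ψ) : Der (.two :: Ξ) (ψ :: Φ.map Tope.wk) (Γ.map Tm.wkC)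
      (.tm C.wkC (.famType A.wkC a.wkC j)) := by
  simpa using hC.tm_wkC hψ

theorem hom_wkC (hf : Der Ξ Φ Γ (.tm f (.hom A a x))) {ψ : Tope}
    (hψ : IsTope (.two :: Ξ) ψ) : Der (.two :: Ξ) (ψ :: Φ.map Tope.wk) (Γ.map Tm.wkC)
      (.tm f.wkC (.hom A.wkC a.wkC x.wkC)) := by
  simpa using hf.tm_wkC hψ

/-- The cone arrow of `id_a` is constant, so the constant function `u` is a lift that ends at `u`.
-/
theorem coneLift_idArr_path (hA : Der Ξ Φ Γ (.tm A (.univ i))) (ha : Der Ξ Φ Γ (.tm a A))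
    (hC : Der Ξ Φ Γ (.tm C (.famType A a j)))
    (hcov : Der Ξ Φ Γ (.tm cov (.isCovariant (.coslice A a) (.uncurry A a C))))
    (hu : Der Ξ Φ Γ (.tm u (.fiberAtId a C))) :
    ∃ p, Der Ξ Φ Γ (.tm p (.id (.fiberAtId a C) (.fst (.coneLift a cov a (.idArr a) u)) u)) := by
  have hi := idArr hA ha
  have hu' := to_uncurry hA ha hC ha hi hu
  have hT := dhomTy (coslice hA ha) (uncurry hA ha hC) (coslice_base hA ha) (coslice_base hA ha)
    (coneArr hA ha ha hi) hu' hu'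
  have key : ∀ {ψ : Tope}, IsTope (.two :: Ξ) ψ →
      Der (.two :: Ξ) (ψ :: Φ.map Tope.wk) (Γ.map Tm.wkC) (.tm u.wkC
        (.app (Tm.uncurry A a C).wkC (.extApp (Tm.coneArr (.idArr a)).wkC (.var 0)))) := by
    intro ψ hψ
    have hD := uncurry (hA.tm_wkC hψ) (ha.tm_wkC hψ) (fam_wkC hC hψ)
    have h := hD.eqRefl.appCong 
      (coneArr_idArr_app (s := .var 0) (hA.tm_wkC hψ) (ha.tm_wkC hψ) (.var rfl)).eqSymm
    refine (hu'.tm_wkC hψ).conv (i := j) ?_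
    simpa using h
  exact coneLift_path hA ha hC hcov ha hi hu hu
    (hT.lam (key .top) (key isTope_left).eqRefl (key isTope_right).eqRefl)

/-- A section `φ` carries the cone arrow to the lift `t ↦ φ (f t) (conn f t)`, which runs from `φ a
id_a` to `φ x f`. -/
theorem coneLift_sections_path (hA : Der Ξ Φ Γ (.tm A (.univ i))) (ha : Der Ξ Φ Γ (.tm a A))
    (hC : Der Ξ Φ Γ (.tm C (.famType A a j)))
    (hcov : Der Ξ Φ Γ (.tm cov (.isCovariant (.coslice A a) (.uncurry A a C))))
    (hx : Der Ξ Φ Γ (.tm x A)) (hf : Der Ξ Φ Γ (.tm f (.hom A a x)))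
    (hφ : Der Ξ Φ Γ (.tm φ (.sections A a C))) :
    ∃ p, Der Ξ Φ Γ (.tm p (.id (.app (.app C x) f)
      (.fst (.coneLift a cov x f (.app (.app φ a) (.idArr a)))) (.app (.app φ x) f))) := by
  have hi := idArr hA ha
  have hu := sections_app hφ ha hi
  have hv := sections_app hφ hx hf
  have hT := dhomTy (coslice hA ha) (uncurry hA ha hC) (coslice_base hA ha)
    (coslice_pair hA ha hx hf) (coneArr hA ha hx hf) (to_uncurry hA ha hC ha hi hu)
    (to_uncurry hA ha hC hx hf hv)
  have hφ' : ∀ {ψ : Tope}, IsTope (.two :: Ξ) ψ →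
      Der (.two :: Ξ) (ψ :: Φ.map Tope.wk) (Γ.map Tm.wkC)
        (.tm φ.wkC (.sections A.wkC a.wkC C.wkC)) := fun hψ => by simpa using hφ.tm_wkC hψ
  have hc : ∀ {ψ : Tope}, IsTope (.two :: Ξ) ψ →
      Der (.two :: Ξ) (ψ :: Φ.map Tope.wk) (Γ.map Tm.wkC)
        (.tm (.conn f.wkC (.var 0)) (.hom A.wkC a.wkC (.extApp f.wkC (.var 0)))) := fun hψ =>
    conn (hA.tm_wkC hψ) (ha.tm_wkC hψ) (hx.tm_wkC hψ) (hom_wkC hf hψ) (.var rfl)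
  -- This identifies the type of `φ (f t) (conn f t)` with the fibre of the uncurried family over
  -- `coneArr f` at `t`.
  have key : ∀ {ψ : Tope}, IsTope (.two :: Ξ) ψ →
      Der (.two :: Ξ) (ψ :: Φ.map Tope.wk) (Γ.map Tm.wkC) (.eq
        (.app (.app C.wkC (.extApp f.wkC (.var 0))) (.conn f.wkC (.var 0)))
        (.app (Tm.uncurry A a C).wkC (.extApp (Tm.coneArr f).wkC (.var 0))) (.univ j)) := by
    intro ψ hψ
    have hA' := hA.tm_wkC hψ
    have ha' := ha.tm_wkC hψ
    have hf' := hom_wkC hf hψ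
    have hC' := fam_wkC hC hψ
    have h := (uncurry hA' ha' hC').eqRefl.appCong
      (coneArr_app (s := .var 0) hA' ha' (hx.tm_wkC hψ) hf' (.var rfl)).eqSymm
    refine (uncurry_pair hA' ha' hC' (hom_app hf' (.var rfl)) (hc hψ)).eqSymm.eqTrans ?_
    simpa using h
  refine coneLift_path hA ha hC hcov hx hf hu hv (hT.lam
    ((sections_app (hφ' .top) (hom_app (hom_wkC hf .top) (.var rfl)) (hc .top)).conv (key .top))
    ?_ ?_)
  · have hψ := isTope_left (Ξ := Ξ)
    have := (sections_app_congr (hφ' hψ).eqRefl (arr_app_left hf (homTy hA ha hx))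
      (conn_at_zero (hA.tm_wkC hψ) (ha.tm_wkC hψ) (hx.tm_wkC hψ) (hom_wkC hf hψ) (.var rfl)
        (.head _))).convEq (key hψ)
    simpa using this
  · have hψ := isTope_right (Ξ := Ξ)
    exact (sections_app_congr (hφ' hψ).eqRefl (arr_app_right hf (homTy hA ha hx))
      (conn_at_one (hA.tm_wkC hψ) (ha.tm_wkC hψ) (hx.tm_wkC hψ) (hom_wkC hf hψ) (.var rfl)
        (.head _))).convEq (key hψ)

end Der

/-! ### The inverse of evaluation and the two homotopies -/

/-- The section of the family `C` with the value `u` at the identity. -/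
def Tm.yon (A a cov u : Tm) : Tm :=
  .lam A (.lam (.hom A.wk a.wk (.var 0))
    (.fst (.coneLift (a.wkN 2) (cov.wkN 2) (.var 1) (.var 0) (u.wkN 2))))

@[simp]
theorem Tm.yon_sub (ρ : ℕ → CTm) (σ : ℕ → Tm) (A a cov u : Tm) :
    (Tm.yon A a cov u).sub ρ σ = .yon (A.sub ρ σ) (a.sub ρ σ) (cov.sub ρ σ) (u.sub ρ σ) := by
  simp [Tm.yon]

/-- A covariant family `C` over the arrows out of `a : A`. -/
structure CovFam (Ξ : List Cube) (Φ : List Tope) (Γ : List Tm) (i j : ℕ) (A a C cov : Tm) :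
    Prop where
  ty : Der Ξ Φ Γ (.tm A (.univ i))
  base : Der Ξ Φ Γ (.tm a A)
  fam : Der Ξ Φ Γ (.tm C (.famType A a j))
  cov : Der Ξ Φ Γ (.tm cov (.isCovariant (.coslice A a) (.uncurry A a C)))

namespace CovFam

variable {Ξ : List Cube} {Φ : List Tope} {Γ : List Tm} {i j k : ℕ}
  {A a x f C u cov φ B : Tm}

theorem wk (h : CovFam Ξ Φ Γ i j A a C cov) (hB : Der Ξ Φ Γ (.tm B (.univ k))) :
    CovFam Ξ Φ (B :: Γ) i j A.wk a.wk C.wk cov.wk :=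
  ⟨h.ty.tm_wk hB, h.base.tm_wk hB, by simpa using h.fam.tm_wk hB, by simpa using h.cov.tm_wk hB⟩

theorem homFam (h : CovFam Ξ Φ Γ i j A a C cov) :
    Der Ξ Φ (A :: Γ) (.tm (.hom A.wk a.wk (.var 0)) (.univ i)) :=
  Der.coslice_fam h.ty h.base

theorem wk₂ (h : CovFam Ξ Φ Γ i j A a C cov) :
    CovFam Ξ Φ (.hom A.wk a.wk (.var 0) :: A :: Γ) i j A.wk.wk a.wk.wk C.wk.wk cov.wk.wk :=
  (h.wk h.ty).wk h.homFam

theorem var₁ (h : CovFam Ξ Φ Γ i j A a C cov) :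
    Der Ξ Φ (.hom A.wk a.wk (.var 0) :: A :: Γ) (.tm (.var 1) A.wk.wk) := by
  simpa using h.ty.var₀.tm_wk h.homFam

theorem var₀ (h : CovFam Ξ Φ Γ i j A a C cov) :
    Der Ξ Φ (.hom A.wk a.wk (.var 0) :: A :: Γ) (.tm (.var 0) (.hom A.wk.wk a.wk.wk (.var 1))) := by
  simpa using h.homFam.var₀

theorem fiber (h : CovFam Ξ Φ Γ i j A a C cov) :
    Der Ξ Φ (.hom A.wk a.wk (.var 0) :: A :: Γ)
      (.tm (.app (.app (C.wkN 2) (.var 1)) (.var 0)) (.univ j)) := by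
  simpa using Der.fam_app h.wk₂.fam h.var₁ h.var₀

theorem inner (h : CovFam Ξ Φ Γ i j A a C cov) :
    Der Ξ Φ (A :: Γ) (.tm (.pi (.hom A.wk a.wk (.var 0))
      (.app (.app (C.wkN 2) (.var 1)) (.var 0))) (.univ (max i j))) :=
  -- Formation of Π-types needs a common universe for the arrows in level `i` and the fibres in
  -- level `j`.
  .pi (h.homFam.cumul_le (le_max_left i j)) (h.fiber.cumul_le (le_max_right i j))

theorem sections (h : CovFam Ξ Φ Γ i j A a C cov) :
    Der Ξ Φ Γ (.tm (.sections A a C) (.univ (max i j))) :=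
  .pi (h.ty.cumul_le (le_max_left i j)) h.inner

theorem fiberAtId (h : CovFam Ξ Φ Γ i j A a C cov) :
    Der Ξ Φ Γ (.tm (.fiberAtId a C) (.univ j)) :=
  Der.fiberAtId h.ty h.base h.fam

theorem wk_fiberAtId (a C : Tm) : (Tm.fiberAtId a C).wk = .fiberAtId a.wk C.wk := by
  simp [Tm.fiberAtId]

theorem fiber₂ (h : CovFam Ξ Φ Γ i j A a C cov) (hu : Der Ξ Φ Γ (.tm u (.fiberAtId a C))) :
    Der Ξ Φ (.hom A.wk a.wk (.var 0) :: A :: Γ) (.tm u.wk.wk (.fiberAtId a.wk.wk C.wk.wk)) := by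
  rw [← wk_fiberAtId, ← wk_fiberAtId]
  exact (hu.tm_wk h.ty).tm_wk h.homFam

theorem yon_body (h : CovFam Ξ Φ Γ i j A a C cov) (hu : Der Ξ Φ Γ (.tm u (.fiberAtId a C))) :
    Der Ξ Φ (.hom A.wk a.wk (.var 0) :: A :: Γ)
      (.tm (.fst (.coneLift (a.wkN 2) (cov.wkN 2) (.var 1) (.var 0) (u.wkN 2)))
        (.app (.app (C.wkN 2) (.var 1)) (.var 0))) := by
  simpa using Der.coneLift_fst h.wk₂.ty h.wk₂.base h.wk₂.fam h.wk₂.cov h.var₁ h.var₀ (h.fiber₂ hu)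

theorem yon (h : CovFam Ξ Φ Γ i j A a C cov) (hu : Der Ξ Φ Γ (.tm u (.fiberAtId a C))) :
    Der Ξ Φ Γ (.tm (.yon A a cov u) (.sections A a C)) :=
  h.ty.lam (h.homFam.lam (h.yon_body hu))

theorem yon_app (h : CovFam Ξ Φ Γ i j A a C cov) (hu : Der Ξ Φ Γ (.tm u (.fiberAtId a C)))
    (hx : Der Ξ Φ Γ (.tm x A)) (hf : Der Ξ Φ Γ (.tm f (.hom A a x))) :
    Der Ξ Φ Γ (.eq (.app (.app (.yon A a cov u) x) f) (.fst (.coneLift a cov x f u))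
      (.app (.app C x) f)) := by
  have h₁ := (h.homFam.lam (h.yon_body hu)).piBeta hx
  simp only [Tm.inst, Tm.tsub, Tm.sub] at h₁
  have h₂ := h₁.appCong (a := f) (a' := f) (by simpa using hf.eqRefl)
  have h₃ := Der.coneLift_fst h.ty h.base h.fam h.cov hx hf hu
  -- With `x` already substituted, the body is typed anew over the single variable for the arrow, so
  -- that the second β-rule applies.
  have h₄ : Der Ξ Φ (.hom A a x :: Γ)
      (.tm (.fst (.coneLift a.wk cov.wk x.wk (.var 0) u.wk)) (.app (.app C.wk x.wk) (.var 0))) := by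
    have hH := Der.hom h.ty h.base hx
    have h' := h.wk hH
    exact Der.coneLift_fst h'.ty h'.base h'.fam h'.cov (hx.tm_wk hH) (by simpa using hH.var₀)
      (by rw [← wk_fiberAtId]; exact hu.tm_wk hH)
  have h₅ := h₄.piBeta hf
  simp [Tm.yon] at h₂ h₅ ⊢
  exact h₂.eqTrans h₅

theorem yon_id_path (h : CovFam Ξ Φ Γ i j A a C cov) (hu : Der Ξ Φ Γ (.tm u (.fiberAtId a C))) :
    ∃ p, Der Ξ Φ Γ (.tm p (.id (.fiberAtId a C)
      (.app (.app (.yon A a cov u) a) (.idArr a)) u)) := by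
  obtain ⟨p, hp⟩ := Der.coneLift_idArr_path h.ty h.base h.fam h.cov hu
  exact ⟨p, hp.conv (.idCong h.fiberAtId.eqRefl
    (h.yon_app hu h.base (Der.idArr h.ty h.base)).eqSymm hu.eqRefl)⟩

/-- Two η-expansions write a section as a double abstraction, the shape in which it can be compared
with `yon` by `lam_path`. -/
theorem sections_eta (h : CovFam Ξ Φ Γ i j A a C cov)
    (hφ : Der Ξ Φ Γ (.tm φ (.sections A a C))) :
    Der Ξ Φ Γ (.eq φ (.lam A (.lam (.hom A.wk a.wk (.var 0))
      (.app (.app (φ.wkN 2) (.var 1)) (.var 0)))) (.sections A a C)) := by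
  refine hφ.piEta.eqTrans (.lamCong h.ty.eqRefl ?_)
  have hφ' : Der Ξ Φ (A :: Γ) (.tm φ.wk (.sections A.wk a.wk C.wk)) := by
    simpa using hφ.tm_wk h.ty
  simpa using (Der.sections_app₁ hφ' h.ty.var₀).piEta

theorem yon_path (h : CovFam Ξ Φ Γ i j A a C cov) (hφ : Der Ξ Φ Γ (.tm φ (.sections A a C))) :
    ∃ p, Der Ξ Φ Γ (.tm p (.id (.sections A a C)
      (.yon A a cov (.app (.app φ a) (.idArr a))) φ)) := by
  have hu := Der.sections_app hφ h.base (Der.idArr h.ty h.base)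
  have hφ' : Der Ξ Φ (.hom A.wk a.wk (.var 0) :: A :: Γ)
      (.tm (φ.wkN 2) (.sections A.wk.wk a.wk.wk C.wk.wk)) := by
    simpa using (hφ.tm_wk h.ty).tm_wk h.homFam
  have hb : Der Ξ Φ (.hom A.wk a.wk (.var 0) :: A :: Γ)
      (.tm (.app (.app (φ.wkN 2) (.var 1)) (.var 0))
        (.app (.app (C.wkN 2) (.var 1)) (.var 0))) := by
    simpa using Der.sections_app hφ' h.var₁ h.var₀
  obtain ⟨p, hp⟩ := Der.coneLift_sections_path h.wk₂.ty h.wk₂.base h.wk₂.fam h.wk₂.cov h.var₁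
    h.var₀ hφ'
  -- The pointwise path at generic `x` and `f` is abstracted first over `f`, then over `x`.
  obtain ⟨q, hq⟩ := Der.lam_path h.homFam h.fiber (h.yon_body hu) hb (p := p) (by simpa using hp)
  obtain ⟨r, hr⟩ := Der.lam_path h.ty h.inner (h.homFam.lam (h.yon_body hu)) (h.homFam.lam hb) hq
  exact ⟨r, hr.conv (.idCong h.sections.eqRefl (h.yon hu).eqRefl (h.sections_eta hφ).eqSymm)⟩

theorem evid_body (h : CovFam Ξ Φ Γ i j A a C cov) :
    Der Ξ Φ (.sections A a C :: Γ)
      (.tm (.app (.app (.var 0) a.wk) (.idArr a.wk)) (Tm.fiberAtId a C).wk) := by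
  have h' := h.wk h.sections
  rw [wk_fiberAtId]
  exact Der.sections_app (by simpa using h.sections.var₀) h'.base (Der.idArr h'.ty h'.base)

theorem evid (h : CovFam Ξ Φ Γ i j A a C cov) :
    Der Ξ Φ Γ (.tm (.evid A a C) (.arrow (.sections A a C) (.fiberAtId a C))) :=
  h.sections.lam h.evid_body

theorem evid_app (h : CovFam Ξ Φ Γ i j A a C cov) (hφ : Der Ξ Φ Γ (.tm φ (.sections A a C))) :
    Der Ξ Φ Γ (.eq (.app (.evid A a C) φ) (.app (.app φ a) (.idArr a)) (.fiberAtId a C)) := by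
  simpa [Tm.evid] using h.evid_body.piBeta hφ

theorem yonLam_body (h : CovFam Ξ Φ Γ i j A a C cov) :
    Der Ξ Φ (.fiberAtId a C :: Γ)
      (.tm (.yon A.wk a.wk cov.wk (.var 0)) (Tm.sections A a C).wk) := by
  have := (h.wk h.fiberAtId).yon (u := .var 0) (by rw [← wk_fiberAtId]; exact h.fiberAtId.var₀)
  simpa using this

/-- Evaluation at the identity is an equivalence. -/
theorem evid_isEquiv (h : CovFam Ξ Φ Γ i j A a C cov) :
    ∃ e, Der Ξ Φ Γ (.tm e (.isEquiv (.sections A a C) (.fiberAtId a C) (.evid A a C))) := by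
  have hS := h.sections
  have hF := h.fiberAtId
  have hg : Der Ξ Φ Γ (.tm (.lam (.fiberAtId a C) (.yon A.wk a.wk cov.wk (.var 0)))
      (.arrow (.fiberAtId a C) (.sections A a C))) := hF.lam h.yonLam_body
  have hvF : Der Ξ Φ (.fiberAtId a C :: Γ) (.tm (.var 0) (.fiberAtId a.wk C.wk)) := by
    rw [← wk_fiberAtId]; exact hF.var₀
  have hvS : Der Ξ Φ (.sections A a C :: Γ) (.tm (.var 0) (.sections A.wk a.wk C.wk)) := by
    simpa using hS.var₀
  have hWF := h.wk hF
  have hWS := h.wk hS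
  have e₁ := Der.beta_wk hF h.yonLam_body
  have e₂ := Der.beta_wk hS h.evid_body
  obtain ⟨p, hp⟩ := hWF.yon_id_path hvF
  obtain ⟨q, hq⟩ := hWS.yon_path hvS
  have hE : Der Ξ Φ (.fiberAtId a C :: Γ) (.tm (Tm.evid A a C).wk
      (.arrow (Tm.sections A a C).wk (Tm.fiberAtId a C).wk)) := by
    simpa using h.evid.tm_wk hF
  have hG := hg.tm_wk hS
  -- The composite on the fibre β-reduces judgmentally to the value of `yon` at the identity, the
  -- term that the path `p` starts from.
  have c₁ : Der Ξ Φ (.fiberAtId a C :: Γ) (.eq (.app (Tm.evid A a C).wk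
      (.app (Tm.lam (.fiberAtId a C) (.yon A.wk a.wk cov.wk (.var 0))).wk (.var 0)))
      (.app (.app (.yon A.wk a.wk cov.wk (.var 0)) a.wk) (.idArr a.wk))
      (.fiberAtId a.wk C.wk)) := by
    have k₁ := hE.eqRefl.appCong e₁
    have k₂ := hWF.evid_app (hWF.yon hvF)
    simp [Tm.fiberAtId] at k₁ k₂ ⊢
    exact k₁.eqTrans k₂
  -- Likewise the composite on sections reduces to `yon` at the value of the section at the
  -- identity, where `q` starts.
  have c₂ : Der Ξ Φ (.sections A a C :: Γ) (.eq
      (.app (Tm.lam (.fiberAtId a C) (.yon A.wk a.wk cov.wk (.var 0))).wk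
        (.app (Tm.evid A a C).wk (.var 0)))
      (.yon A.wk a.wk cov.wk (.app (.app (.var 0) a.wk) (.idArr a.wk)))
      (.sections A.wk a.wk C.wk)) := by
    have hG' : Der Ξ Φ (.sections A a C :: Γ)
        (.tm (Tm.lam (.fiberAtId a C) (.yon A.wk a.wk cov.wk (.var 0))).wk
          (.arrow (Tm.fiberAtId a C).wk (Tm.sections A a C).wk)) := by simpa using hG
    have k₁ := hG'.eqRefl.appCong e₂
    have k₂ := hWS.yonLam_body.piBeta
      (Der.sections_app hvS hWS.base (Der.idArr hWS.ty hWS.base))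
    simp [Tm.fiberAtId, Tm.evid] at k₁ k₂ ⊢
    exact k₁.eqTrans k₂
  -- The fibre lives in level `j` and is lifted to `max i j` to share a universe with the type of
  -- sections.
  refine Der.isEquiv hS (hF.cumul_le (le_max_right i j)) h.evid hg (p := p) (q := q)
    (hp.conv (i := j) ?_) (hq.conv (i := max i j) ?_)
  · rw [wk_fiberAtId]
    exact .idCong hWF.fiberAtId.eqRefl c₁.eqSymm hvF.eqRefl
  · have e : (Tm.sections A a C).wk = .sections A.wk a.wk C.wk := by simp
    rw [e]
    exact .idCong hWS.sections.eqRefl c₂.eqSymm hvS.eqRefl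

end CovFam
end STT

theorem mainTheorem1 (Ξ : List STT.Cube) (Φ : List STT.Tope) (Γ : List STT.Tm) (i j : ℕ)
    (A seg a C cov : STT.Tm)
    (hA : STT.Der Ξ Φ Γ (.tm A (.univ i)))
    (hseg : STT.Der Ξ Φ Γ (.tm seg (STT.Tm.isSegal A)))
    (ha : STT.Der Ξ Φ Γ (.tm a A))
    (hC : STT.Der Ξ Φ Γ (.tm C (STT.Tm.famType A a j)))
    (hcov : STT.Der Ξ Φ Γ
      (.tm cov (STT.Tm.isCovariant (STT.Tm.coslice A a) (STT.Tm.uncurry A a C)))) :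
    ∃ e : STT.Tm, STT.Der Ξ Φ Γ
      (.tm e (STT.Tm.isEquiv (STT.Tm.sections A a C) (STT.Tm.fiberAtId a C)
        (STT.Tm.evid A a C))) :=
  STT.CovFam.evid_isEquiv ⟨hA, ha, hC, hcov⟩
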